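/- For a positive integer $n$ let $\Omega(n)$ denote the number of prime factors of $n$, counted with multiplicity (so $\Omega(1)=0$). For integers $N\ge 3$ and $n \ge 1$ put $$\varphi_N(n)=\frac{\Omega(n)-\log\log N}{\sqrt{\log\log N}}.$$ Let $F:\mathbb{R}\to\mathbb{C}$ be a continuous function with compact support, and let $a:\{0,1,2,\dots\}\to\mathbb{C}$ be bounded. Then $$\frac1N\sum_{n=1}^{N}F(\varphi_N(n))\,a(\Omega(n))=\frac1N\sum_{n=1}^{N}F(\varphi_N(n))\,a(\Omega(n)+1)+o(1)\qquad (N\to\infty).$$ -/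

import Mathlib

/-- The normalized prime-factor count `φ_N(n) = (Ω(n) - log log N) / √(log log N)`, where `Ω(n)`
is the number of prime factors of `n` counted with multiplicity. -/
noncomputable def normalizedOmega (N n : ℕ) : ℝ :=
  ((ArithmeticFunction.cardFactors n : ℝ) - Real.log (Real.log (N : ℝ))) /
    Real.sqrt (Real.log (Real.log (N : ℝ)))

/-! The core is a statement about total variation: for `f` bounded by 1, the mean `M_f(y)` of
`f(Ω(n))` over `n ≤ e^y` differs from that of `f(Ω(n)+1)` by `o(1)`, uniformly in `f`. Uniformity
allows `f` to depend on `N`; taking `f` proportional to `F(φ_N)·a` gives the theorem, because adding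
one to `Ω` moves `φ_N` by only `1/√(log log N)` and `F` is uniformly continuous.

Let `f'(k) = f(k+1)`. Since `Ω(pm) = Ω(m)+1` for every prime `p`, a weighted Turán–Kubilius
inequality gives `W·M_f(y) ≈ ∑ w_p M_{f'}(y - log p)`, where `W = ∑ w_p`, as soon as every `p·w_p`
is small (`norm_mul_logMean_sub_sum_sq_le`). If mean values vary slowly under bounded shifts of `y`,
the right side is about `W·M_{f'}(y)`, as desired.

Slow variation comes from the same identity with well-chosen weights (`exists_weights`). Placed at
`log n`, the masses `σΛ(n)n^{-1-σ}` imitate the exponential law `σe^{-σt}dt`, with error `O(σ)` on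
smoothed functions: the pole of `-ζ'/ζ` at 1 is the transform of that law, and the remainder is
holomorphic up to `Re s = 1` because `ζ` has no zeros there. The exponential law is itself invariant
under translation by `s` up to `O(σs)`. Hence the right side of the identity barely changes from `y`
to `y - s`, and neither does `M_f`. Smoothing is harmless because mean values are almost Lipschitz
in `y`. -/

/-! ### Mean values on a logarithmic scale -/

/-- The mean value over `1 ≤ n ≤ exp y` of an arithmetic function, as a function of `y`. -/
noncomputable def logMean (b : ℕ → ℂ) (y : ℝ) : ℂ :=
  (Real.exp (-y) : ℂ) * ∑ n ∈ Finset.Icc 1 ⌊Real.exp y⌋₊, b n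

lemma norm_sum_le_natCast_of_norm_le_one {b : ℕ → ℂ} (hb : ∀ n, ‖b n‖ ≤ 1) (s : Finset ℕ) :
    ‖∑ n ∈ s, b n‖ ≤ s.card := by
  simpa using norm_sum_le_of_le s (fun n _ => hb n)

lemma norm_ofReal_exp (y : ℝ) : ‖(Real.exp y : ℂ)‖ = Real.exp y := by
  rw [Complex.norm_real, Real.norm_of_nonneg (Real.exp_pos _).le]

lemma norm_logMean_le_one {b : ℕ → ℂ} (hb : ∀ n, ‖b n‖ ≤ 1) (y : ℝ) : ‖logMean b y‖ ≤ 1 := by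
  have h1 := norm_sum_le_natCast_of_norm_le_one hb (Finset.Icc 1 ⌊Real.exp y⌋₊)
  rw [Nat.card_Icc, Nat.add_sub_cancel] at h1
  have h2 := Nat.floor_le (Real.exp_pos y).le
  rw [logMean, norm_mul, norm_ofReal_exp]
  calc _ ≤ Real.exp (-y) * Real.exp y := by gcongr; exact h1.trans h2
    _ = 1 := by rw [← Real.exp_add]; simp

lemma measurable_logMean (b : ℕ → ℂ) : Measurable (logMean b) := by
  unfold logMean
  refine Measurable.mul (by fun_prop) ?_
  exact (measurable_from_nat (f := fun N => ∑ n ∈ Finset.Icc 1 N, b n)).comp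
    (Nat.measurable_floor.comp Real.measurable_exp)

/-- Passing from `x` to `y` rescales the old terms and adds at most `e^y - e^x + 1` new ones. Each
effect costs at most `1 - e^{x-y} ≤ y - x`; the extra `e^{-y}` pays for the integer parts. -/
lemma norm_logMean_sub_le_of_le {b : ℕ → ℂ} (hb : ∀ n, ‖b n‖ ≤ 1) {x y : ℝ} (hxy : x ≤ y) :
    ‖logMean b y - logMean b x‖ ≤ 2 * (y - x) + Real.exp (-y) := by
  set N := ⌊Real.exp y⌋₊
  set M := ⌊Real.exp x⌋₊
  have hMN : M ≤ N := Nat.floor_mono (Real.exp_le_exp.2 hxy)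
  have hsplit : ∑ n ∈ Finset.Icc 1 N, b n
      = ∑ n ∈ Finset.Icc 1 M, b n + ∑ n ∈ Finset.Icc (M + 1) N, b n := by
    have h := Finset.sum_Ioc_consecutive b (Nat.zero_le M) hMN
    simpa only [← Finset.Icc_add_one_left_eq_Ioc, zero_add] using h.symm
  have h1 := norm_sum_le_natCast_of_norm_le_one hb (Finset.Icc 1 M)
  have h2 := norm_sum_le_natCast_of_norm_le_one hb (Finset.Icc (M + 1) N)
  rw [Nat.card_Icc, Nat.add_sub_cancel] at h1
  rw [Nat.card_Icc, Nat.add_sub_add_right, Nat.cast_sub hMN] at h2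
  have hN : (N : ℝ) ≤ Real.exp y := Nat.floor_le (Real.exp_pos y).le
  have hM : (M : ℝ) ≤ Real.exp x := Nat.floor_le (Real.exp_pos x).le
  have hM' : Real.exp x < M + 1 := Nat.lt_floor_add_one _
  have hexp : Real.exp (-y) ≤ Real.exp (-x) := Real.exp_le_exp.2 (by linarith)
  have e1 : Real.exp (-y) * Real.exp y = 1 := by rw [← Real.exp_add]; simp
  have e2 : Real.exp (-x) * Real.exp x = 1 := by rw [← Real.exp_add]; simp
  have e3 : 1 - (y - x) ≤ Real.exp (-y) * Real.exp x := by
    rw [← Real.exp_add]; have := Real.add_one_le_exp (-y + x); linarith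
  have hEq : logMean b y - logMean b x
      = ((Real.exp (-y) - Real.exp (-x) : ℝ) : ℂ) * ∑ n ∈ Finset.Icc 1 M, b n
        + (Real.exp (-y) : ℂ) * ∑ n ∈ Finset.Icc (M + 1) N, b n := by
    simp only [logMean]; rw [hsplit]; push_cast; ring
  have b1 : ‖((Real.exp (-y) - Real.exp (-x) : ℝ) : ℂ) * ∑ n ∈ Finset.Icc 1 M, b n‖
      ≤ (Real.exp (-x) - Real.exp (-y)) * Real.exp x := by
    rw [norm_mul, Complex.norm_real, Real.norm_of_nonpos (by linarith), neg_sub]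
    exact mul_le_mul_of_nonneg_left (h1.trans hM) (by linarith)
  have b2 : ‖(Real.exp (-y) : ℂ) * ∑ n ∈ Finset.Icc (M + 1) N, b n‖
      ≤ Real.exp (-y) * (Real.exp y - Real.exp x + 1) := by
    rw [norm_mul, norm_ofReal_exp]
    exact mul_le_mul_of_nonneg_left (h2.trans (by linarith)) (Real.exp_pos _).le
  rw [hEq]
  refine (norm_add_le _ _).trans ((add_le_add b1 b2).trans ?_)
  nlinarith [e1, e2, e3]

lemma norm_logMean_sub_le {b : ℕ → ℂ} (hb : ∀ n, ‖b n‖ ≤ 1) (y x : ℝ) :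
    ‖logMean b y - logMean b x‖ ≤ 2 * |y - x| + Real.exp (-y) := by
  rcases le_total x y with h | h
  · rw [abs_of_nonneg (by linarith)]; exact norm_logMean_sub_le_of_le hb h
  · rw [norm_sub_rev, abs_of_nonpos (by linarith), neg_sub]
    refine (norm_logMean_sub_le_of_le hb h).trans ?_
    have : Real.exp (-x) ≤ Real.exp (-y) := Real.exp_le_exp.2 (by linarith)
    linarith

/-! ### The weighted Turán–Kubilius inequality -/

lemma card_filter_dvd_Icc (N d : ℕ) : ((Finset.Icc 1 N).filter (d ∣ ·)).card = N / d := by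
  simpa only [← Finset.Icc_add_one_left_eq_Ioc, zero_add] using Nat.Ioc_filter_dvd_card_eq_div N d

lemma sum_filter_dvd_Icc (N : ℕ) {d : ℕ} (hd : 0 < d) (b : ℕ → ℂ) :
    ∑ n ∈ (Finset.Icc 1 N).filter (d ∣ ·), b n = ∑ m ∈ Finset.Icc 1 (N / d), b (d * m) := by
  symm
  refine Finset.sum_bij (fun m _ => d * m) ?_ ?_ ?_ ?_
  · intro m hm
    rw [Finset.mem_Icc] at hm
    rw [Finset.mem_filter, Finset.mem_Icc]
    refine ⟨⟨Nat.mul_pos hd hm.1, ?_⟩, dvd_mul_right _ _⟩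
    exact (Nat.mul_le_mul_left d hm.2).trans (Nat.mul_div_le N d)
  · intro m _ m' _ h
    exact Nat.eq_of_mul_eq_mul_left hd h
  · intro n hn
    rw [Finset.mem_filter, Finset.mem_Icc] at hn
    obtain ⟨⟨h1, h2⟩, m, rfl⟩ := hn
    refine ⟨m, ?_, rfl⟩
    rw [Finset.mem_Icc]
    exact ⟨Nat.pos_of_mul_pos_left h1, (Nat.le_div_iff_mul_le hd).2 (by linarith [mul_comm d m])⟩
  · intros; rfl

/-- The weighted Turán–Kubilius variance bound. -/
lemma sum_sq_sub_sum_dvd_le {P : Finset ℕ} (hP : ∀ p ∈ P, p.Prime) {w : ℕ → ℝ}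
    (hw : ∀ p ∈ P, 0 ≤ w p) {η : ℝ} (hη : ∀ p ∈ P, p * w p ≤ η) {X : ℝ} (hX : 0 ≤ X) :
    ∑ n ∈ Finset.Icc 1 ⌊X⌋₊, (∑ p ∈ P, w p - ∑ p ∈ P, if p ∣ n then p * w p else 0) ^ 2
      ≤ η * (∑ p ∈ P, w p) * X + 2 * (∑ p ∈ P, w p) * ∑ p ∈ P, p * w p := by
  set W := ∑ p ∈ P, w p with hWdef
  set N := ⌊X⌋₊ with hN
  have hW : 0 ≤ W := Finset.sum_nonneg hw
  have hNX : (N : ℝ) ≤ X := Nat.floor_le hX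
  have cnt : ∀ d : ℕ, ∑ n ∈ Finset.Icc 1 N, (if d ∣ n then (1 : ℝ) else 0) = ((N / d : ℕ) : ℝ) := by
    intro d
    rw [← card_filter_dvd_Icc, Finset.card_filter]
    push_cast; rfl
  have hup : ∀ d : ℕ, 0 < d → ((N / d : ℕ) : ℝ) ≤ X / d := fun d hd =>
    Nat.cast_div_le.trans (by gcongr)
  have hlow : ∀ d : ℕ, X / d - 1 ≤ ((N / d : ℕ) : ℝ) := by
    intro d
    rw [hN, ← Nat.floor_div_natCast]
    linarith [Nat.lt_floor_add_one (X / d)]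
  have hexpand : ∑ n ∈ Finset.Icc 1 N, (W - ∑ p ∈ P, if p ∣ n then p * w p else 0) ^ 2
      = W ^ 2 * N - 2 * W * ∑ p ∈ P, p * w p * ((N / p : ℕ) : ℝ)
        + ∑ p ∈ P, ∑ q ∈ P, (p * w p) * (q * w q) *
          ∑ n ∈ Finset.Icc 1 N, (if p ∣ n ∧ q ∣ n then (1 : ℝ) else 0) := by
    have e1 : ∑ p ∈ P, p * w p * ((N / p : ℕ) : ℝ)
        = ∑ n ∈ Finset.Icc 1 N, ∑ p ∈ P, (if p ∣ n then p * w p else 0) := by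
      rw [Finset.sum_comm]
      refine Finset.sum_congr rfl fun p _ => ?_
      rw [← cnt p, Finset.mul_sum]
      exact Finset.sum_congr rfl fun n _ => by split_ifs <;> simp
    have e2 : ∑ p ∈ P, ∑ q ∈ P, (p * w p) * (q * w q) *
          ∑ n ∈ Finset.Icc 1 N, (if p ∣ n ∧ q ∣ n then (1 : ℝ) else 0)
        = ∑ n ∈ Finset.Icc 1 N, (∑ p ∈ P, if p ∣ n then p * w p else 0) ^ 2 := by
      simp_rw [sq, Finset.sum_mul_sum, Finset.mul_sum]
      rw [Finset.sum_comm (s := Finset.Icc 1 N)]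
      refine Finset.sum_congr rfl fun p _ => ?_
      rw [Finset.sum_comm]
      refine Finset.sum_congr rfl fun n _ => Finset.sum_congr rfl fun q _ => ?_
      by_cases h1 : p ∣ n <;> by_cases h2 : q ∣ n <;> simp [h1, h2]
    have e3 : W ^ 2 * N = ∑ n ∈ Finset.Icc 1 N, W ^ 2 := by simp [mul_comm]
    rw [e1, e2, e3, Finset.mul_sum, ← Finset.sum_sub_distrib, ← Finset.sum_add_distrib]
    exact Finset.sum_congr rfl fun n _ => by ring
  -- Off the diagonal, coprimality yields the density `1/(pq)`. On the diagonal one factor `p * w p`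
  -- is sacrificed to `η`.
  have hcross : ∑ p ∈ P, ∑ q ∈ P, (p * w p) * (q * w q) *
          ∑ n ∈ Finset.Icc 1 N, (if p ∣ n ∧ q ∣ n then (1 : ℝ) else 0)
      ≤ ∑ p ∈ P, ∑ q ∈ P, (w p * w q * X + if p = q then η * w p * X else 0) := by
    refine Finset.sum_le_sum fun p hp => Finset.sum_le_sum fun q hq => ?_
    have hp0 : (0 : ℝ) < p := by exact_mod_cast (hP p hp).pos
    have hq0 : (0 : ℝ) < q := by exact_mod_cast (hP q hq).pos
    have hwp := hw p hp
    have hwq := hw q hq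
    by_cases hpq : p = q
    · subst hpq
      simp only [and_self, if_true, cnt]
      calc (p * w p) * (p * w p) * ((N / p : ℕ) : ℝ)
          ≤ (p * w p) * (p * w p) * (X / p) := by
            gcongr; exact hup p (hP p hp).pos
        _ = (p * w p) * (w p * X) := by field_simp
        _ ≤ η * (w p * X) := by gcongr; exact hη p hp
        _ ≤ _ := by nlinarith [mul_nonneg (mul_nonneg hwp hwp) hX]
    · have hco : Nat.Coprime p q := (Nat.coprime_primes (hP p hp) (hP q hq)).2 hpq
      have : ∀ n, (p ∣ n ∧ q ∣ n) ↔ p * q ∣ n := fun n =>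
        ⟨fun h => hco.mul_dvd_of_dvd_of_dvd h.1 h.2,
          fun h => ⟨(dvd_mul_right _ _).trans h, (dvd_mul_left _ _).trans h⟩⟩
      simp only [this, cnt, if_neg hpq, add_zero]
      calc (p * w p) * (q * w q) * ((N / (p * q) : ℕ) : ℝ)
          ≤ (p * w p) * (q * w q) * (X / ((p * q : ℕ) : ℝ)) := by
            gcongr; exact hup (p * q) (Nat.mul_pos (hP p hp).pos (hP q hq).pos)
        _ = w p * w q * X := by push_cast; field_simp
  have hcross' : ∑ p ∈ P, ∑ q ∈ P, (w p * w q * X + if p = q then η * w p * X else 0)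
      = W ^ 2 * X + η * W * X := by
    simp_rw [Finset.sum_add_distrib, Finset.sum_ite_eq]
    rw [sq, hWdef, Finset.sum_mul_sum, Finset.sum_mul]
    congr 1
    · exact Finset.sum_congr rfl fun p _ => by rw [Finset.sum_mul]
    · rw [Finset.mul_sum, Finset.sum_mul]
      exact Finset.sum_congr rfl fun p hp => by simp [hp]
  have hlin : W * X - ∑ p ∈ P, p * w p ≤ ∑ p ∈ P, p * w p * ((N / p : ℕ) : ℝ) := by
    rw [hWdef, Finset.sum_mul, ← Finset.sum_sub_distrib]
    refine Finset.sum_le_sum fun p hp => ?_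
    have hp0 : (0 : ℝ) < p := by exact_mod_cast (hP p hp).pos
    have hwp := hw p hp
    calc w p * X - p * w p = p * w p * (X / p - 1) := by field_simp
      _ ≤ _ := by gcongr; exact hlow p
  -- The terms of size `W ^ 2 * X` cancel, leaving the diagonal and the rounding loss in `hlin`.
  rw [hexpand]
  nlinarith [hcross, hcross', mul_le_mul_of_nonneg_left hlin hW,
    mul_le_mul_of_nonneg_left hNX (sq_nonneg W)]

/-- A weighted Turán–Kubilius identity for mean values of bounded arithmetic functions. -/
lemma norm_mul_logMean_sub_sum_sq_le {P : Finset ℕ} (hP : ∀ p ∈ P, p.Prime) {w : ℕ → ℝ}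
    (hw : ∀ p ∈ P, 0 ≤ w p) {η : ℝ} (hη : ∀ p ∈ P, p * w p ≤ η)
    {b : ℕ → ℂ} (hb : ∀ n, ‖b n‖ ≤ 1) (y : ℝ) :
    ‖((∑ p ∈ P, w p : ℝ) : ℂ) * logMean b y
        - ∑ p ∈ P, (w p : ℂ) * logMean (fun m => b (p * m)) (y - Real.log p)‖ ^ 2
      ≤ η * (∑ p ∈ P, w p) + 2 * (∑ p ∈ P, w p) * (∑ p ∈ P, p * w p) * Real.exp (-y) := by
  have hvar := sum_sq_sub_sum_dvd_le hP hw hη (Real.exp_pos y).le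
  set W := ∑ p ∈ P, w p with hWdef
  set N := ⌊Real.exp y⌋₊ with hN
  set c : ℕ → ℝ := fun n => ∑ p ∈ P, if p ∣ n then p * w p else 0 with hc
  have hNX : (N : ℝ) ≤ Real.exp y := Nat.floor_le (Real.exp_pos y).le
  have e0 : Real.exp (-y) * Real.exp y = 1 := by rw [← Real.exp_add]; simp
  -- Substituting `n = p * m` turns the mean up to `e^y / p` into a sum over the multiples of `p` up
  -- to `e^y`.
  have hterm : ∀ p ∈ P, (w p : ℂ) * logMean (fun m => b (p * m)) (y - Real.log p)
      = (Real.exp (-y) : ℂ) * ∑ n ∈ Finset.Icc 1 N, b n * ((if p ∣ n then p * w p else 0 : ℝ) : ℂ) := by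
    intro p hp
    have hp0 : (0 : ℝ) < p := by exact_mod_cast (hP p hp).pos
    have h1 : Real.exp (-(y - Real.log p)) = Real.exp (-y) * p := by
      rw [show -(y - Real.log p) = -y + Real.log p by ring, Real.exp_add, Real.exp_log hp0]
    have h2 : ⌊Real.exp (y - Real.log p)⌋₊ = N / p := by
      rw [Real.exp_sub, Real.exp_log hp0, Nat.floor_div_natCast]
    rw [logMean, h1, h2, ← sum_filter_dvd_Icc N (hP p hp).pos, Finset.sum_filter]
    simp only [Finset.mul_sum]
    refine Finset.sum_congr rfl fun n _ => ?_
    split_ifs <;> push_cast <;> ring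
  have hEq : ((W : ℝ) : ℂ) * logMean b y
        - ∑ p ∈ P, (w p : ℂ) * logMean (fun m => b (p * m)) (y - Real.log p)
      = (Real.exp (-y) : ℂ) * ∑ n ∈ Finset.Icc 1 N, b n * ((W - c n : ℝ) : ℂ) := by
    rw [Finset.sum_congr rfl hterm, ← Finset.mul_sum, Finset.sum_comm, logMean, ← mul_assoc,
      mul_comm (W : ℂ), mul_assoc, ← mul_sub, Finset.mul_sum, ← Finset.sum_sub_distrib]
    congr 1
    refine Finset.sum_congr rfl fun n _ => ?_
    rw [hc, ← Finset.mul_sum]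
    push_cast
    ring
  -- Cauchy–Schwarz removes `b` and leaves the variance.
  have hcs : ‖∑ n ∈ Finset.Icc 1 N, b n * ((W - c n : ℝ) : ℂ)‖ ^ 2
      ≤ N * ∑ n ∈ Finset.Icc 1 N, (W - c n) ^ 2 := by
    have h1 : ‖∑ n ∈ Finset.Icc 1 N, b n * ((W - c n : ℝ) : ℂ)‖
        ≤ ∑ n ∈ Finset.Icc 1 N, |W - c n| := by
      refine norm_sum_le_of_le _ fun n _ => ?_
      rw [norm_mul, Complex.norm_real, Real.norm_eq_abs]
      exact mul_le_of_le_one_left (abs_nonneg _) (hb n)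
    have h2 := sq_sum_le_card_mul_sum_sq (s := Finset.Icc 1 N) (f := fun n => |W - c n|)
    simp only [sq_abs, Nat.card_Icc, Nat.add_sub_cancel] at h2
    exact (pow_le_pow_left₀ (norm_nonneg _) h1 2).trans h2
  rw [hEq, norm_mul, norm_ofReal_exp, mul_pow]
  have hpos : 0 ≤ ∑ n ∈ Finset.Icc 1 N, (W - c n) ^ 2 := Finset.sum_nonneg fun _ _ => sq_nonneg _
  calc _ ≤ Real.exp (-y) ^ 2 * (Real.exp y * (η * W * Real.exp y + 2 * W * ∑ p ∈ P, p * w p)) := by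
        refine mul_le_mul_of_nonneg_left (hcs.trans ?_) (sq_nonneg _)
        exact mul_le_mul hNX hvar hpos (Real.exp_pos _).le
    _ = (Real.exp (-y) * Real.exp y) ^ 2 * (η * W)
        + (Real.exp (-y) * Real.exp y) * (2 * W * (∑ p ∈ P, p * w p) * Real.exp (-y)) := by ring
    _ = _ := by rw [e0]; ring

/-! ### Zeta on the line `Re s = 1` and Fourier bounds -/

open scoped FourierTransform

/-- The logarithmic derivative of `(s - 1) ζ(s)` extends `-ζ'/ζ - 1/(s-1)` holomorphically to a
neighbourhood of the closed half-plane `1 ≤ re s`. -/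
lemma exists_LSeries_vonMangoldt_eq_add :
    ∃ (A : ℂ → ℂ) (U : Set ℂ), IsOpen U ∧ {s : ℂ | 1 ≤ s.re} ⊆ U ∧ DifferentiableOn ℂ A U ∧
      ∀ s : ℂ, 1 < s.re →
        LSeries (fun n => (ArithmeticFunction.vonMangoldt n : ℂ)) s = 1 / (s - 1) + A s := by
  -- `Z` is `(s-1)ζ(s)` with the pole filled in. Non-vanishing of `ζ` on `Re s ≥ 1` makes `-Z'/Z`
  -- holomorphic there.
  set Z := DirichletCharacter.LFunctionTrivChar₁ 1 with hZ
  have hZd : Differentiable ℂ Z := DirichletCharacter.differentiable_LFunctionTrivChar₁ 1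
  have hZeq : ∀ s, s ≠ 1 → Z s = (s - 1) * riemannZeta s := by
    intro s hs
    rw [hZ, DirichletCharacter.LFunctionTrivChar₁, Function.update_of_ne hs]
    simp [DirichletCharacter.LFunctionTrivChar]
  have hZ1 : Z 1 ≠ 0 := DirichletCharacter.LFunctionTrivChar₁_apply_one_ne_zero 1
  refine ⟨fun s => -deriv Z s / Z s, {s | Z s ≠ 0}, isOpen_ne_fun hZd.continuous continuous_const,
    ?_, ?_, ?_⟩
  · intro s hs
    rcases eq_or_ne s 1 with rfl | h
    · exact hZ1
    · show Z s ≠ 0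
      rw [hZeq s h]
      exact mul_ne_zero (sub_ne_zero.2 h) (riemannZeta_ne_zero_of_one_le_re hs)
  · refine DifferentiableOn.div ?_ hZd.differentiableOn fun s hs => hs
    exact fun s _ => (hZd.analyticAt s).deriv.differentiableAt.differentiableWithinAt.neg
  · intro s hs
    have h1 : s ≠ 1 := by rintro rfl; simp at hs
    have hd : deriv Z s = (s - 1) * deriv riemannZeta s + riemannZeta s := by
      have := DirichletCharacter.deriv_LFunctionTrivChar₁_apply_of_ne_one 1 h1
      simpa [DirichletCharacter.LFunctionTrivChar] using this
    have hz := riemannZeta_ne_zero_of_one_le_re hs.le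
    have h1' := sub_ne_zero.2 h1
    rw [ArithmeticFunction.LSeries_vonMangoldt_eq_deriv_riemannZeta_div hs]
    simp only [hd, hZeq s h1]
    field_simp
    ring

/-- The Fourier transform of a twice differentiable function is integrable, with an explicit
bound. -/
lemma integrable_fourier_and_integral_norm_le {Φ : ℝ → ℂ} (hΦ : ContDiff ℝ 2 Φ)
    (hsupp : HasCompactSupport Φ) {C : ℝ} (h0 : ∫ x, ‖Φ x‖ ≤ C)
    (h2 : ∫ x, ‖deriv (deriv Φ) x‖ ≤ C) :
    MeasureTheory.Integrable (𝓕 Φ) ∧ ∫ x, ‖𝓕 Φ x‖ ≤ 2 * Real.pi * C := by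
  have hint : ∀ n : ℕ, n ≤ (2 : ℕ∞) → MeasureTheory.Integrable (iteratedDeriv n Φ) := by
    intro n hn
    refine (hΦ.continuous_iteratedDeriv n (by exact_mod_cast hn)).integrable_of_hasCompactSupport ?_
    rw [iteratedDeriv_eq_equiv_comp]
    exact (hsupp.iteratedFDeriv n).comp_left (map_zero _)
  have hf2 := Real.fourier_iteratedDeriv (N := 2) (n := 2) (by exact_mod_cast hΦ) hint le_rfl
  have hd2 : iteratedDeriv 2 Φ = deriv (deriv Φ) := by
    rw [iteratedDeriv_succ, iteratedDeriv_one]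
  -- Two derivatives give decay `1/(1+x²)`, whose integral is `π`; the factor `(2π)²` is discarded
  -- as at least 1.
  have hpt : ∀ x : ℝ, ‖𝓕 Φ x‖ ≤ 2 * C * (1 + x ^ 2)⁻¹ := by
    intro x
    have b0 : ‖𝓕 Φ x‖ ≤ C := (VectorFourier.norm_fourierIntegral_le_integral_norm _ _ _ _ _).trans h0
    have b2 : ‖𝓕 (iteratedDeriv 2 Φ) x‖ ≤ C := by
      rw [hd2]
      exact (VectorFourier.norm_fourierIntegral_le_integral_norm _ _ _ _ _).trans h2
    rw [hf2, norm_smul, norm_pow] at b2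
    have e : ‖(2 * Real.pi * Complex.I * x : ℂ)‖ ^ 2 = (2 * Real.pi) ^ 2 * x ^ 2 := by
      simp [mul_pow]
    rw [e] at b2
    have hpi : (1 : ℝ) ≤ (2 * Real.pi) ^ 2 := by nlinarith [Real.pi_gt_three]
    have b3 : x ^ 2 * ‖𝓕 Φ x‖ ≤ C := by
      refine le_trans ?_ b2
      rw [mul_assoc]
      exact le_mul_of_one_le_left (by positivity) hpi
    rw [← div_eq_mul_inv, le_div_iff₀ (by positivity)]
    linarith
  have hcont : Continuous (𝓕 Φ) :=
    VectorFourier.fourierIntegral_continuous Real.continuous_fourierChar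
      (by fun_prop) (by simpa using hint 0 (by simp))
  have hbd : MeasureTheory.Integrable fun x : ℝ => 2 * C * (1 + x ^ 2)⁻¹ :=
    integrable_inv_one_add_sq.const_mul _
  have hI : MeasureTheory.Integrable (𝓕 Φ) :=
    hbd.mono' hcont.aestronglyMeasurable (.of_forall hpt)
  refine ⟨hI, (MeasureTheory.integral_mono hI.norm hbd hpt).trans ?_⟩
  rw [MeasureTheory.integral_const_mul, integral_univ_inv_one_add_sq]
  linarith

/-- Uniform `L¹` bounds for Fourier transforms of a holomorphic function localised to vertical
segments. -/
lemma exists_integral_norm_fourier_mul_le {A : ℂ → ℂ} {U : Set ℂ} (hU : IsOpen U)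
    (hUre : {s : ℂ | 1 ≤ s.re} ⊆ U) (hA : DifferentiableOn ℂ A U) {ψ : ℝ → ℂ}
    (hψ : ContDiff ℝ 2 ψ) (hψs : HasCompactSupport ψ) (κ : ℝ) :
    ∃ C : ℝ, 0 ≤ C ∧ ∀ σ ∈ Set.Icc (0 : ℝ) 1,
      MeasureTheory.Integrable (𝓕 fun τ : ℝ => ψ τ * A (1 + σ - κ * τ * Complex.I)) ∧
      ∫ x, ‖𝓕 (fun τ : ℝ => ψ τ * A (1 + σ - κ * τ * Complex.I)) x‖ ≤ C := by
  have hmem : ∀ σ ∈ Set.Icc (0 : ℝ) 1, ∀ τ : ℝ, (1 + σ - κ * τ * Complex.I : ℂ) ∈ U := by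
    intro σ hσ τ
    apply hUre
    simpa using hσ.1
  have hA1 : DifferentiableOn ℂ (deriv A) U := hA.deriv hU
  have hA2 : DifferentiableOn ℂ (deriv (deriv A)) U := hA1.deriv hU
  -- The endpoint `σ = 0` is included, so compactness makes the bounds uniform as `σ → 0`.
  set K : Set (ℝ × ℝ) := Set.Icc (0 : ℝ) 1 ×ˢ tsupport ψ with hK
  have hKc : IsCompact K := isCompact_Icc.prod hψs
  have hbound : ∀ B : ℂ → ℂ, DifferentiableOn ℂ B U → ∃ M : ℝ, 0 ≤ M ∧ ∀ σ ∈ Set.Icc (0 : ℝ) 1,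
      ∀ τ ∈ tsupport ψ, ‖B (1 + σ - κ * τ * Complex.I)‖ ≤ M := by
    intro B hB
    have hc : ContinuousOn (fun z : ℝ × ℝ => B (1 + z.1 - κ * z.2 * Complex.I)) K :=
      hB.continuousOn.comp (by fun_prop) fun z hz => hmem z.1 hz.1 z.2
    obtain ⟨M, hM⟩ := hKc.exists_bound_of_continuousOn hc
    exact ⟨max M 0, le_max_right _ _, fun σ hσ τ hτ => (hM (σ, τ) ⟨hσ, hτ⟩).trans (le_max_left _ _)⟩
  obtain ⟨M0, hM0, hb0⟩ := hbound A hA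
  obtain ⟨M1, hM1, hb1⟩ := hbound _ hA1
  obtain ⟨M2, hM2, hb2⟩ := hbound _ hA2
  have hψ1 : ContDiff ℝ 1 (deriv ψ) := ((contDiff_succ_iff_deriv (n := 1)).1 hψ).2.2
  have hψ2 : Continuous (deriv (deriv ψ)) := hψ1.continuous_deriv le_rfl
  have hs1 : HasCompactSupport (deriv ψ) := hψs.deriv
  have hs2 : HasCompactSupport (deriv (deriv ψ)) := hs1.deriv
  set c : ℂ := -(κ * Complex.I) with hc
  have ht1 : tsupport (deriv ψ) ⊆ tsupport ψ := closure_minimal (support_deriv_subset) isClosed_closure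
  have ht2 : tsupport (deriv (deriv ψ)) ⊆ tsupport ψ :=
    (closure_minimal (support_deriv_subset) isClosed_closure).trans ht1
  have i0 := (hψ.continuous.integrable_of_hasCompactSupport hψs (μ := MeasureTheory.volume)).norm
  have i1 := (hψ1.continuous.integrable_of_hasCompactSupport hs1 (μ := MeasureTheory.volume)).norm
  have i2 := (hψ2.integrable_of_hasCompactSupport hs2 (μ := MeasureTheory.volume)).norm
  -- The first summand bounds `∫‖Φ‖`; the others bound `∫‖Φ''‖` through `Φ'' = ψ''A + 2cψ'A' +
  -- c²ψA''`.
  set D : ℝ := (M0 * ∫ x, ‖ψ x‖) + (M0 * (∫ x, ‖deriv (deriv ψ) x‖)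
    + (2 * ‖c‖ * M1 * (∫ x, ‖deriv ψ x‖) + ‖c‖ ^ 2 * M2 * ∫ x, ‖ψ x‖)) with hD
  have hint_nn : ∀ g : ℝ → ℂ, 0 ≤ ∫ x, ‖g x‖ := fun g =>
    MeasureTheory.integral_nonneg fun _ => norm_nonneg _
  refine ⟨2 * Real.pi * D, ?_, ?_⟩
  · have := hint_nn ψ
    have := hint_nn (deriv ψ)
    have := hint_nn (deriv (deriv ψ))
    positivity
  intro σ hσ
  have hcomp : ∀ B : ℂ → ℂ, DifferentiableOn ℂ B U → ∀ τ : ℝ,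
      HasDerivAt (fun τ : ℝ => B (1 + σ - κ * τ * Complex.I))
        (deriv B (1 + σ - κ * τ * Complex.I) * c) τ := by
    intro B hB τ
    have h1 : HasDerivAt (fun τ : ℝ => (1 + σ - κ * τ * Complex.I : ℂ)) c τ := by
      have h := (((Complex.ofRealCLM.hasDerivAt (x := τ)).const_mul (κ : ℂ)).mul_const
        Complex.I).const_sub (1 + σ : ℂ)
      simpa [hc] using h
    exact HasDerivAt.comp τ (hB.differentiableAt (hU.mem_nhds (hmem σ hσ τ))).hasDerivAt h1
  set Φ : ℝ → ℂ := fun τ => ψ τ * A (1 + σ - κ * τ * Complex.I) with hΦ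
  have hline : ContDiff ℝ 2 fun τ : ℝ => (1 + σ - κ * τ * Complex.I : ℂ) := by
    have : ContDiff ℝ 2 fun τ : ℝ => (τ : ℂ) := Complex.ofRealCLM.contDiff
    fun_prop
  have hΦc : ContDiff ℝ 2 Φ := by
    refine hψ.mul ?_
    exact ContDiffOn.comp_contDiff ((hA.contDiffOn hU (n := 2)).restrict_scalars ℝ) hline
      (hmem σ hσ)
  have hΦs : HasCompactSupport Φ := hψs.mul_right
  have hd1 : deriv Φ = fun τ => deriv ψ τ * A (1 + σ - κ * τ * Complex.I)
      + ψ τ * (deriv A (1 + σ - κ * τ * Complex.I) * c) := funext fun τ =>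
    (((hψ.differentiable (by norm_num)) τ).hasDerivAt.mul (hcomp A hA τ)).deriv
  have hd2 : deriv (deriv Φ) = fun τ => deriv (deriv ψ) τ * A (1 + σ - κ * τ * Complex.I)
      + deriv ψ τ * (deriv A (1 + σ - κ * τ * Complex.I) * c)
      + (deriv ψ τ * (deriv A (1 + σ - κ * τ * Complex.I) * c)
        + ψ τ * (deriv (deriv A) (1 + σ - κ * τ * Complex.I) * c * c)) := by
    rw [hd1]
    funext τ
    exact ((((hψ1.differentiable (by norm_num)) τ).hasDerivAt.mul (hcomp A hA τ)).add
      (((hψ.differentiable (by norm_num)) τ).hasDerivAt.mul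
        ((hcomp _ hA1 τ).mul_const c))).deriv
  have hmul : ∀ (g : ℝ → ℂ), tsupport g ⊆ tsupport ψ → ∀ (B : ℂ → ℂ) (M : ℝ),
      (∀ τ ∈ tsupport ψ, ‖B (1 + σ - κ * τ * Complex.I)‖ ≤ M) → ∀ τ : ℝ,
      ‖g τ‖ * ‖B (1 + σ - κ * τ * Complex.I)‖ ≤ M * ‖g τ‖ := by
    intro g hg B M hB τ
    by_cases h : τ ∈ tsupport g
    · rw [mul_comm]
      exact mul_le_mul_of_nonneg_right (hB τ (hg h)) (norm_nonneg _)
    · simp [image_eq_zero_of_notMem_tsupport h]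
  have hn0 : ∫ x, ‖Φ x‖ ≤ M0 * ∫ x, ‖ψ x‖ := by
    rw [← MeasureTheory.integral_const_mul]
    refine MeasureTheory.integral_mono_of_nonneg (.of_forall fun _ => norm_nonneg _)
      (i0.const_mul _) (.of_forall fun τ => ?_)
    simpa [hΦ] using hmul ψ subset_rfl A M0 (hb0 σ hσ) τ
  have hn2 : ∫ x, ‖deriv (deriv Φ) x‖ ≤ M0 * (∫ x, ‖deriv (deriv ψ) x‖)
      + (2 * ‖c‖ * M1 * (∫ x, ‖deriv ψ x‖) + ‖c‖ ^ 2 * M2 * ∫ x, ‖ψ x‖) := by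
    have i01 : MeasureTheory.Integrable fun x =>
        2 * ‖c‖ * M1 * ‖deriv ψ x‖ + ‖c‖ ^ 2 * M2 * ‖ψ x‖ := (i1.const_mul _).add (i0.const_mul _)
    rw [← MeasureTheory.integral_const_mul, ← MeasureTheory.integral_const_mul,
      ← MeasureTheory.integral_const_mul, ← MeasureTheory.integral_add (i1.const_mul _)
      (i0.const_mul _), ← MeasureTheory.integral_add (i2.const_mul _) i01]
    refine MeasureTheory.integral_mono_of_nonneg (.of_forall fun _ => norm_nonneg _)
      ((i2.const_mul _).add i01) (.of_forall fun τ => ?_)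
    have a0 := hmul _ ht2 A M0 (hb0 σ hσ) τ
    have a1 := mul_le_mul_of_nonneg_left (hmul _ ht1 (deriv A) M1 (hb1 σ hσ) τ) (norm_nonneg c)
    have a2 := mul_le_mul_of_nonneg_left
      (hmul ψ subset_rfl (deriv (deriv A)) M2 (hb2 σ hσ) τ) (sq_nonneg ‖c‖)
    rw [hd2]
    refine (norm_add_le _ _).trans ((add_le_add (norm_add_le _ _) (norm_add_le _ _)).trans ?_)
    simp only [norm_mul]
    linarith
  refine integrable_fourier_and_integral_norm_le hΦc hΦs (hn0.trans ?_) (hn2.trans ?_)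
  · have := hint_nn (deriv ψ)
    have := hint_nn (deriv (deriv ψ))
    have := hint_nn ψ
    rw [hD]
    exact le_add_of_nonneg_right (by positivity)
  · have := hint_nn ψ
    rw [hD]
    exact le_add_of_nonneg_left (by positivity)

/-! ### Smoothing and comparison of measures -/

/-- The convolution of `G` with the dilate of the kernel `k` to scale `ε`. -/
noncomputable def smoothing (k : ℝ → ℂ) (ε : ℝ) (G : ℝ → ℂ) (y : ℝ) : ℂ :=
  ∫ u, k u * G (y - ε * u)

lemma integrable_mul_of_norm_le_one {k g : ℝ → ℂ} {μ : MeasureTheory.Measure ℝ}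
    (hk : MeasureTheory.Integrable k μ) (hg : Measurable g) (hg1 : ∀ y, ‖g y‖ ≤ 1) :
    MeasureTheory.Integrable (fun u => k u * g u) μ :=
  hk.mul_bdd (c := 1) hg.aestronglyMeasurable (.of_forall hg1)

lemma norm_smoothing_le {k : ℝ → ℂ} (hk : MeasureTheory.Integrable k) {G : ℝ → ℂ}
    (hG1 : ∀ y, ‖G y‖ ≤ 1) (ε y : ℝ) :
    ‖smoothing k ε G y‖ ≤ ∫ u, ‖k u‖ := by
  refine MeasureTheory.norm_integral_le_of_norm_le hk.norm (.of_forall fun u => ?_)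
  rw [norm_mul]
  exact mul_le_of_le_one_right (norm_nonneg _) (hG1 _)

lemma measurable_smoothing {k : ℝ → ℂ} (hk : Measurable k) {G : ℝ → ℂ} (hG : Measurable G)
    (ε : ℝ) : Measurable (smoothing k ε G) := by
  unfold smoothing
  have h : Measurable fun z : ℝ × ℝ => k z.2 * G (z.1 - ε * z.2) := by fun_prop
  exact (h.stronglyMeasurable.integral_prod_right').measurable

/-- As `k` has integral 1, the difference is a `k`-average of increments over steps `ε * u`, to
which the almost-Lipschitz bound applies. -/
lemma norm_smoothing_logMean_sub_le {k : ℝ → ℂ} (hk : MeasureTheory.Integrable k)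
    (hk' : MeasureTheory.Integrable fun u => |u| * ‖k u‖) (hk1 : ∫ u, k u = 1)
    {ε : ℝ} (hε : 0 ≤ ε) {b : ℕ → ℂ} (hb : ∀ n, ‖b n‖ ≤ 1) (y : ℝ) :
    ‖smoothing k ε (logMean b) y - logMean b y‖
      ≤ 2 * ε * (∫ u, |u| * ‖k u‖) + (∫ u, ‖k u‖) * Real.exp (-y) := by
  have h1 : MeasureTheory.Integrable fun u => k u * logMean b (y - ε * u) :=
    integrable_mul_of_norm_le_one hk ((measurable_logMean b).comp (by fun_prop))
      fun _ => norm_logMean_le_one hb _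
  have h2 : smoothing k ε (logMean b) y - logMean b y
      = ∫ u, k u * (logMean b (y - ε * u) - logMean b y) := by
    have h3 : logMean b y = ∫ u, k u * logMean b y := by
      rw [MeasureTheory.integral_mul_const, hk1, one_mul]
    conv_lhs => rw [smoothing, h3]
    rw [← MeasureTheory.integral_sub h1 (hk.mul_const _)]
    simp_rw [mul_sub]
  rw [h2, ← MeasureTheory.integral_const_mul, ← MeasureTheory.integral_mul_const,
    ← MeasureTheory.integral_add (hk'.const_mul _) (hk.norm.mul_const _)]
  refine MeasureTheory.norm_integral_le_of_norm_le ((hk'.const_mul _).add (hk.norm.mul_const _))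
    (.of_forall fun u => ?_)
  have h4 := norm_logMean_sub_le hb y (y - ε * u)
  rw [norm_sub_rev, sub_sub_cancel, abs_mul, abs_of_nonneg hε] at h4
  rw [norm_mul]
  have h5 := mul_le_mul_of_nonneg_left h4 (norm_nonneg (k u))
  linarith

section FiniteMeasure

variable {ψ : ℝ → ℂ} {ε : ℝ} {G : ℝ → ℂ}

/-- The characteristic function of `m`, evaluated at the frequency `2πτ/ε`. -/
noncomputable def dilatedCharFun (ε : ℝ) (m : MeasureTheory.Measure ℝ) (τ : ℝ) : ℂ :=
  ∫ t, Complex.exp (((2 * Real.pi / ε) * τ * t : ℝ) * Complex.I) ∂m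

lemma integrable_fourierKernel (hψ : MeasureTheory.Integrable ψ)
    (m : MeasureTheory.Measure ℝ) [MeasureTheory.IsFiniteMeasure m] (v : ℝ) :
    MeasureTheory.Integrable (fun z : ℝ × ℝ =>
      Complex.exp (((-2 * Real.pi * z.2 * (v - z.1 / ε) : ℝ) : ℂ) * Complex.I) * ψ z.2)
      (m.prod MeasureTheory.volume) := by
  have h1 : MeasureTheory.Integrable (fun z : ℝ × ℝ => (1 : ℂ) * ψ z.2)
      (m.prod MeasureTheory.volume) := (MeasureTheory.integrable_const (1 : ℂ)).mul_prod hψ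
  simp only [one_mul] at h1
  refine h1.bdd_mul (c := 1) ?_ (.of_forall fun z => ?_)
  · exact Continuous.aestronglyMeasurable (by fun_prop)
  · rw [Complex.norm_exp_ofReal_mul_I]

/-- Translating `𝓕 ψ` multiplies `ψ` by a character; by Fubini, averaging over `m` turns the
characters into the characteristic function. -/
lemma integral_fourier_sub_eq (hψ : MeasureTheory.Integrable ψ)
    (m : MeasureTheory.Measure ℝ) [MeasureTheory.IsFiniteMeasure m] (v : ℝ) :
    ∫ t, 𝓕 ψ (v - t / ε) ∂m = 𝓕 (fun τ => ψ τ * dilatedCharFun ε m τ) v := by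
  simp_rw [Real.fourier_real_eq_integral_exp_smul, smul_eq_mul]
  rw [MeasureTheory.integral_integral_swap (integrable_fourierKernel hψ m v)]
  congr 1 with τ
  have h : ∫ t, Complex.exp (((-2 * Real.pi * τ * (v - t / ε) : ℝ) : ℂ) * Complex.I) ∂m
      = Complex.exp (((-2 * Real.pi * τ * v : ℝ) : ℂ) * Complex.I) * dilatedCharFun ε m τ := by
    rw [dilatedCharFun, ← MeasureTheory.integral_const_mul]
    congr 1 with t
    rw [← Complex.exp_add]
    congr 1
    push_cast
    ring
  rw [MeasureTheory.integral_mul_const, h]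
  ring

lemma integrable_mul_dilatedCharFun (hψ : MeasureTheory.Integrable ψ)
    (m : MeasureTheory.Measure ℝ) [MeasureTheory.IsFiniteMeasure m] :
    MeasureTheory.Integrable fun τ => ψ τ * dilatedCharFun ε m τ := by
  have h := (integrable_fourierKernel (ε := ε) hψ m 0).integral_prod_right
  refine h.congr (.of_forall fun τ => ?_)
  simp only [dilatedCharFun]
  rw [MeasureTheory.integral_mul_const, mul_comm]
  congr 1
  refine MeasureTheory.integral_congr_ae (.of_forall fun t => ?_)
  simp only
  congr 1
  push_cast
  ring

lemma integrable_prod_sub {k : ℝ → ℂ} (hkc : Measurable k) (hk : MeasureTheory.Integrable k)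
    (m : MeasureTheory.Measure ℝ) [MeasureTheory.IsFiniteMeasure m] :
    MeasureTheory.Integrable (fun z : ℝ × ℝ => k (z.2 - z.1 / ε)) (m.prod MeasureTheory.volume) := by
  have hm : Measurable fun z : ℝ × ℝ => k (z.2 - z.1 / ε) := by fun_prop
  rw [MeasureTheory.integrable_prod_iff hm.aestronglyMeasurable]
  refine ⟨.of_forall fun t => hk.comp_sub_right (t / ε), ?_⟩
  have : ∀ t : ℝ, ∫ v, ‖k (v - t / ε)‖ = ∫ v, ‖k v‖ := fun t =>
    MeasureTheory.integral_sub_right_eq_self (fun v => ‖k v‖) (t / ε)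
  simp_rw [this]
  exact MeasureTheory.integrable_const _

/-- The substitution `v = u + t / ε` moves the translation from `G` to the kernel, so nothing beyond
boundedness and measurability is asked of `G`. -/
lemma integral_smoothing_eq (hψ : MeasureTheory.Integrable ψ) (hk : MeasureTheory.Integrable (𝓕 ψ))
    (hkc : Measurable (𝓕 ψ)) (hε : ε ≠ 0) (hG : Measurable G) (hG1 : ∀ y, ‖G y‖ ≤ 1)
    (m : MeasureTheory.Measure ℝ) [MeasureTheory.IsFiniteMeasure m] (y : ℝ) :
    ∫ t, smoothing (𝓕 ψ) ε G (y - t) ∂m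
      = ∫ v, 𝓕 (fun τ => ψ τ * dilatedCharFun ε m τ) v * G (y - ε * v) := by
  have h1 : ∀ t, smoothing (𝓕 ψ) ε G (y - t) = ∫ v, 𝓕 ψ (v - t / ε) * G (y - ε * v) := by
    intro t
    rw [smoothing, ← MeasureTheory.integral_sub_right_eq_self _ (t / ε)]
    refine MeasureTheory.integral_congr_ae (.of_forall fun v => ?_)
    simp only
    congr 2
    field_simp
    ring
  simp_rw [h1, ← integral_fourier_sub_eq hψ m]
  rw [MeasureTheory.integral_integral_swap]
  · simp_rw [MeasureTheory.integral_mul_const]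
  · have hm : Measurable fun z : ℝ × ℝ => G (y - ε * z.2) := by fun_prop
    exact (integrable_prod_sub hkc hk m).mul_bdd (c := 1) hm.aestronglyMeasurable
      (.of_forall fun z => hG1 _)

/-- Integrals of a smoothed bounded function against two finite measures are close as soon as
their characteristic functions are, in the Fourier algebra norm. -/
lemma norm_integral_smoothing_sub_le (hψ : MeasureTheory.Integrable ψ)
    (hk : MeasureTheory.Integrable (𝓕 ψ)) (hkc : Measurable (𝓕 ψ)) (hε : ε ≠ 0)
    (hG : Measurable G) (hG1 : ∀ y, ‖G y‖ ≤ 1)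
    (m₁ m₂ : MeasureTheory.Measure ℝ) [MeasureTheory.IsFiniteMeasure m₁]
    [MeasureTheory.IsFiniteMeasure m₂] (y : ℝ) :
    ‖∫ t, smoothing (𝓕 ψ) ε G (y - t) ∂m₁ - ∫ t, smoothing (𝓕 ψ) ε G (y - t) ∂m₂‖
      ≤ ∫ v, ‖𝓕 (fun τ => ψ τ * (dilatedCharFun ε m₁ τ - dilatedCharFun ε m₂ τ)) v‖ := by
  have hI : ∀ (m : MeasureTheory.Measure ℝ) [MeasureTheory.IsFiniteMeasure m],
      MeasureTheory.Integrable (𝓕 (fun τ => ψ τ * dilatedCharFun ε m τ)) := by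
    intro m _
    refine (integrable_prod_sub (ε := ε) hkc hk m).integral_prod_right.congr (.of_forall fun v => ?_)
    exact integral_fourier_sub_eq hψ m v
  have hGm : Measurable fun v => G (y - ε * v) := by fun_prop
  have hsub : ∀ v, 𝓕 (fun τ => ψ τ * (dilatedCharFun ε m₁ τ - dilatedCharFun ε m₂ τ)) v
      = 𝓕 (fun τ => ψ τ * dilatedCharFun ε m₁ τ) v - 𝓕 (fun τ => ψ τ * dilatedCharFun ε m₂ τ) v := by
    intro v
    have i1 := (Real.fourierIntegral_convergent_iff v).2
      (integrable_mul_dilatedCharFun (ε := ε) hψ m₁)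
    have i2 := (Real.fourierIntegral_convergent_iff v).2
      (integrable_mul_dilatedCharFun (ε := ε) hψ m₂)
    simp only [Real.fourier_eq]
    rw [← MeasureTheory.integral_sub i1 i2]
    simp_rw [mul_sub, smul_sub]
  rw [integral_smoothing_eq hψ hk hkc hε hG hG1, integral_smoothing_eq hψ hk hkc hε hG hG1,
    ← MeasureTheory.integral_sub (integrable_mul_of_norm_le_one (hI m₁) hGm fun _ => hG1 _)
      (integrable_mul_of_norm_le_one (hI m₂) hGm fun _ => hG1 _)]
  have hdiff := ((hI m₁).sub (hI m₂)).norm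
  refine MeasureTheory.norm_integral_le_of_norm_le
    (hdiff.congr (.of_forall fun v => by simp [hsub])) (.of_forall fun v => ?_)
  rw [← sub_mul, ← hsub, norm_mul]
  exact mul_le_of_le_one_right (norm_nonneg _) (hG1 _)

end FiniteMeasure

/-! ### Von Mangoldt weights against the exponential law -/

/-- The weight `σ Λ(n) n^{-1-σ}`. -/
noncomputable def mangoldtWeight (σ : ℝ) (n : ℕ) : ℝ :=
  σ * ArithmeticFunction.vonMangoldt n * (n : ℝ) ^ (-(1 + σ))

lemma mangoldtWeight_nonneg {σ : ℝ} (hσ : 0 ≤ σ) (n : ℕ) : 0 ≤ mangoldtWeight σ n :=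
  mul_nonneg (mul_nonneg hσ ArithmeticFunction.vonMangoldt_nonneg) (by positivity)

lemma mangoldtWeight_mul_exp (σ x : ℝ) (n : ℕ) :
    (mangoldtWeight σ n : ℂ) * Complex.exp ((x * Real.log n : ℝ) * Complex.I)
      = σ * LSeries.term (fun n => (ArithmeticFunction.vonMangoldt n : ℂ))
          (1 + σ - x * Complex.I) n := by
  rcases eq_or_ne n 0 with rfl | hn
  · simp [mangoldtWeight]
  have hn' : (0 : ℝ) < n := by exact_mod_cast Nat.pos_of_ne_zero hn
  have hnc : (n : ℂ) ≠ 0 := by exact_mod_cast hn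
  rw [LSeries.term_of_ne_zero hn, mangoldtWeight, Real.rpow_def_of_pos hn',
    Complex.cpow_def_of_ne_zero hnc, div_eq_mul_inv, ← Complex.exp_neg, Complex.ofReal_mul,
    Complex.ofReal_mul, Complex.ofReal_exp, mul_assoc, mul_assoc, ← Complex.exp_add,
    ← Complex.natCast_log]
  congr 3
  push_cast
  ring

lemma hasSum_mangoldtWeight_mul_exp {σ : ℝ} (hσ : 0 < σ) (x : ℝ) :
    HasSum (fun n => (mangoldtWeight σ n : ℂ) * Complex.exp ((x * Real.log n : ℝ) * Complex.I))
      (σ * LSeries (fun n => (ArithmeticFunction.vonMangoldt n : ℂ)) (1 + σ - x * Complex.I)) := by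
  simp_rw [mangoldtWeight_mul_exp]
  exact (ArithmeticFunction.LSeriesSummable_vonMangoldt (by simpa using hσ)).LSeriesHasSum.mul_left _

lemma summable_mangoldtWeight {σ : ℝ} (hσ : 0 < σ) : Summable (mangoldtWeight σ) := by
  have h := (hasSum_mangoldtWeight_mul_exp hσ 0).summable
  simp only [zero_mul, Complex.ofReal_zero, Complex.exp_zero, mul_one] at h
  exact_mod_cast h

/-- The discrete measure with mass `σ Λ(n) n^{-1-σ}` at `log n`. -/
noncomputable def mangoldtMeasure (σ : ℝ) : MeasureTheory.Measure ℝ :=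
  MeasureTheory.Measure.sum fun n : ℕ =>
    ENNReal.ofReal (mangoldtWeight σ n) • MeasureTheory.Measure.dirac (Real.log n)

lemma isFiniteMeasure_mangoldtMeasure {σ : ℝ} (hσ : 0 < σ) :
    MeasureTheory.IsFiniteMeasure (mangoldtMeasure σ) := by
  constructor
  rw [mangoldtMeasure, MeasureTheory.Measure.sum_apply _ MeasurableSet.univ]
  simp only [MeasureTheory.Measure.smul_apply, MeasureTheory.measure_univ, smul_eq_mul, mul_one]
  rw [← ENNReal.ofReal_tsum_of_nonneg (mangoldtWeight_nonneg hσ.le) (summable_mangoldtWeight hσ)]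
  exact ENNReal.ofReal_lt_top

lemma integral_mangoldtMeasure {σ : ℝ} (hσ : 0 < σ) (f : ℝ → ℂ) :
    ∫ t, f t ∂(mangoldtMeasure σ) = ∑' n : ℕ, (mangoldtWeight σ n : ℂ) * f (Real.log n) := by
  rw [mangoldtMeasure, MeasureTheory.integral_sum_dirac fun _ => ENNReal.ofReal_ne_top]
  refine tsum_congr fun n => ?_
  rw [ENNReal.toReal_ofReal (mangoldtWeight_nonneg hσ.le n), Complex.real_smul]

/-- The exponential distribution with rate `σ`. -/
noncomputable def exponentialMeasure (σ : ℝ) : MeasureTheory.Measure ℝ :=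
  (MeasureTheory.volume.restrict (Set.Ioi 0)).withDensity
    fun t => ENNReal.ofReal (σ * Real.exp (-σ * t))

lemma integrable_exponentialDensity {σ : ℝ} (hσ : 0 < σ) :
    MeasureTheory.IntegrableOn (fun t => σ * Real.exp (-σ * t)) (Set.Ioi 0) :=
  (integrableOn_exp_mul_Ioi (neg_lt_zero.2 hσ) 0).const_mul σ

lemma isFiniteMeasure_exponentialMeasure {σ : ℝ} (hσ : 0 < σ) :
    MeasureTheory.IsFiniteMeasure (exponentialMeasure σ) :=
  MeasureTheory.isFiniteMeasure_withDensity_ofReal (integrable_exponentialDensity hσ).2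

lemma integral_exponentialMeasure {σ : ℝ} (hσ : 0 < σ) (f : ℝ → ℂ) :
    ∫ t, f t ∂(exponentialMeasure σ)
      = ∫ t in Set.Ioi 0, ((σ * Real.exp (-σ * t) : ℝ) : ℂ) * f t := by
  rw [exponentialMeasure, integral_withDensity_eq_integral_toReal_smul (by fun_prop)
    (.of_forall fun _ => ENNReal.ofReal_lt_top)]
  congr 1 with t
  rw [ENNReal.toReal_ofReal (by positivity), Complex.real_smul]

lemma dilatedCharFun_mangoldtMeasure {σ : ℝ} (hσ : 0 < σ) (ε τ : ℝ) :
    dilatedCharFun ε (mangoldtMeasure σ) τ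
      = σ * LSeries (fun n => (ArithmeticFunction.vonMangoldt n : ℂ))
          (1 + σ - (2 * Real.pi / ε : ℝ) * τ * Complex.I) := by
  rw [dilatedCharFun, integral_mangoldtMeasure hσ, (hasSum_mangoldtWeight_mul_exp hσ _).tsum_eq]
  push_cast
  rfl

lemma dilatedCharFun_exponentialMeasure {σ : ℝ} (hσ : 0 < σ) (ε τ : ℝ) :
    dilatedCharFun ε (exponentialMeasure σ) τ
      = σ * (1 / (σ - (2 * Real.pi / ε : ℝ) * τ * Complex.I)) := by
  rw [dilatedCharFun, integral_exponentialMeasure hσ]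
  have h := integral_exp_mul_complex_Ioi
    (a := -(σ - (2 * Real.pi / ε : ℝ) * τ * Complex.I)) (by simpa using hσ) 0
  rw [Complex.ofReal_zero, mul_zero, Complex.exp_zero, neg_div_neg_eq] at h
  rw [← h, ← MeasureTheory.integral_const_mul]
  congr 1 with t
  rw [Complex.ofReal_mul, mul_assoc, Complex.ofReal_exp, ← Complex.exp_add]
  congr 2
  push_cast
  ring

/-- The measures `σ Λ(n) n^{-1-σ} δ_{log n}` and `σ e^{-σ t} dt` agree to within `O(σ)` on smoothed
functions: this is the prime number theorem in an averaged form. -/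
lemma exists_norm_tsum_sub_integral_le {ψ : ℝ → ℂ} (hψ : ContDiff ℝ 2 ψ)
    (hψs : HasCompactSupport ψ) (hk : MeasureTheory.Integrable (𝓕 ψ)) (hkc : Measurable (𝓕 ψ))
    {ε : ℝ} (hε : ε ≠ 0) :
    ∃ C : ℝ, 0 ≤ C ∧ ∀ σ : ℝ, 0 < σ → σ ≤ 1 → ∀ G : ℝ → ℂ, Measurable G → (∀ y, ‖G y‖ ≤ 1) →
      ∀ y : ℝ, ‖∑' n : ℕ, (mangoldtWeight σ n : ℂ) * smoothing (𝓕 ψ) ε G (y - Real.log n)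
        - ∫ t, smoothing (𝓕 ψ) ε G (y - t) ∂(exponentialMeasure σ)‖ ≤ C * σ := by
  obtain ⟨A, U, hU, hUre, hA, hLA⟩ := exists_LSeries_vonMangoldt_eq_add
  obtain ⟨C, hC, hCA⟩ := exists_integral_norm_fourier_mul_le hU hUre hA hψ hψs (2 * Real.pi / ε)
  refine ⟨C, hC, fun σ hσ hσ1 G hG hG1 y => ?_⟩
  have := isFiniteMeasure_mangoldtMeasure hσ
  have := isFiniteMeasure_exponentialMeasure hσ
  have hψi : MeasureTheory.Integrable ψ := hψ.continuous.integrable_of_hasCompactSupport hψs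
  rw [← integral_mangoldtMeasure hσ fun t => smoothing (𝓕 ψ) ε G (y - t)]
  refine (norm_integral_smoothing_sub_le hψi hk hkc hε hG hG1 _ _ y).trans ?_
  -- The pole `1/(s-1)` is exactly the exponential term. What survives carries the factor `σ`, which
  -- is the whole gain.
  have hdiff : (fun τ => ψ τ * (dilatedCharFun ε (mangoldtMeasure σ) τ
        - dilatedCharFun ε (exponentialMeasure σ) τ))
      = (σ : ℂ) • fun τ : ℝ => ψ τ * A (1 + σ - (2 * Real.pi / ε : ℝ) * τ * Complex.I) := by
    funext τ
    rw [dilatedCharFun_mangoldtMeasure hσ, dilatedCharFun_exponentialMeasure hσ,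
      hLA _ (by simpa using hσ), Pi.smul_apply, smul_eq_mul]
    rw [show (1 + σ - (2 * Real.pi / ε : ℝ) * τ * Complex.I - 1 : ℂ)
      = σ - (2 * Real.pi / ε : ℝ) * τ * Complex.I by ring]
    ring
  have hsm : ∀ (g : ℝ → ℂ) (v : ℝ), 𝓕 ((σ : ℂ) • g) v = σ * 𝓕 g v := by
    intro g v
    simp only [Real.fourier_real_eq_integral_exp_smul, Pi.smul_apply, smul_eq_mul]
    rw [← MeasureTheory.integral_const_mul]
    congr 1 with t
    ring
  rw [hdiff]
  simp_rw [hsm, norm_mul, Complex.norm_real, Real.norm_of_nonneg hσ.le]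
  rw [MeasureTheory.integral_const_mul, mul_comm]
  exact mul_le_mul_of_nonneg_right (hCA σ ⟨hσ.le, hσ1⟩).2 hσ.le

/-- Translating a bounded function by `s` changes its exponential mean by at most `O(σ s)`. -/
lemma norm_integral_exponentialMeasure_sub_le {σ : ℝ} (hσ : 0 < σ) {H : ℝ → ℂ} (hH : Measurable H)
    {B : ℝ} (hB : ∀ y, ‖H y‖ ≤ B) {s : ℝ} (hs : 0 ≤ s) (y : ℝ) :
    ‖∫ t, H (y - t) ∂(exponentialMeasure σ) - ∫ t, H (y - s - t) ∂(exponentialMeasure σ)‖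
      ≤ 2 * B * s * σ := by
  have hB0 : 0 ≤ B := (norm_nonneg _).trans (hB 0)
  have hint : ∀ y, MeasureTheory.IntegrableOn
      (fun t => ((σ * Real.exp (-σ * t) : ℝ) : ℂ) * H (y - t)) (Set.Ioi 0) := by
    intro y
    have h1 : MeasureTheory.IntegrableOn (fun t => ((σ * Real.exp (-σ * t) : ℝ) : ℂ)) (Set.Ioi 0) :=
      (integrable_exponentialDensity hσ).ofReal
    have h2 : Measurable fun t => H (y - t) := by fun_prop
    exact h1.mul_bdd (c := B) h2.aestronglyMeasurable (.of_forall fun t => hB _)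
  have hden : ∫ t in Set.Ioi (0 : ℝ), σ * Real.exp (-σ * t) = 1 := by
    rw [MeasureTheory.integral_const_mul, integral_exp_mul_Ioi (neg_lt_zero.2 hσ)]
    simp [hσ.ne']
  have hbd : ∀ y, ‖∫ t in Set.Ioi 0, ((σ * Real.exp (-σ * t) : ℝ) : ℂ) * H (y - t)‖ ≤ B := by
    intro y
    have h := MeasureTheory.norm_integral_le_of_norm_le
      (f := fun t => ((σ * Real.exp (-σ * t) : ℝ) : ℂ) * H (y - t))
      ((integrable_exponentialDensity hσ).mul_const B) (.of_forall fun t => by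
        rw [norm_mul, Complex.norm_real, Real.norm_of_nonneg (by positivity)]
        exact mul_le_mul_of_nonneg_left (hB _) (by positivity))
    rwa [MeasureTheory.integral_mul_const, hden, one_mul] at h
  -- Memorylessness: beyond `s` the law is `e^{-σs}` times its own translate, and `(0, s]` has mass
  -- at most `σs`.
  have hsplit : ∫ t in Set.Ioi 0, ((σ * Real.exp (-σ * t) : ℝ) : ℂ) * H (y - t)
      = (∫ t in Set.Ioc 0 s, ((σ * Real.exp (-σ * t) : ℝ) : ℂ) * H (y - t))
        + (Real.exp (-σ * s) : ℂ) *
          ∫ t in Set.Ioi 0, ((σ * Real.exp (-σ * t) : ℝ) : ℂ) * H (y - s - t) := by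
    rw [← Set.Ioc_union_Ioi_eq_Ioi hs, MeasureTheory.setIntegral_union
      (Set.Ioc_disjoint_Ioi le_rfl) measurableSet_Ioi
      ((hint y).mono_set Set.Ioc_subset_Ioi_self) ((hint y).mono_set (Set.Ioi_subset_Ioi hs))]
    congr 1
    rw [← MeasureTheory.integral_const_mul]
    have h := (MeasureTheory.measurePreserving_add_right MeasureTheory.volume s).setIntegral_preimage_emb
      (measurableEmbedding_addRight s)
      (fun t => ((σ * Real.exp (-σ * t) : ℝ) : ℂ) * H (y - t)) (Set.Ioi s)
    rw [Set.preimage_add_const_Ioi, sub_self] at h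
    rw [Set.Ioc_union_Ioi_eq_Ioi hs, ← h]
    congr 1 with t
    rw [← sub_sub, sub_right_comm, mul_add, Real.exp_add]
    push_cast
    ring
  have hfirst : ‖∫ t in Set.Ioc 0 s, ((σ * Real.exp (-σ * t) : ℝ) : ℂ) * H (y - t)‖ ≤ σ * B * s := by
    have h := MeasureTheory.norm_setIntegral_le_of_norm_le_const (s := Set.Ioc 0 s)
      (μ := MeasureTheory.volume) (C := σ * B)
      (f := fun t => ((σ * Real.exp (-σ * t) : ℝ) : ℂ) * H (y - t)) (by simp) fun t ht => by
        rw [norm_mul, Complex.norm_real, Real.norm_of_nonneg (by positivity)]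
        refine mul_le_mul ?_ (hB _) (norm_nonneg _) hσ.le
        refine mul_le_of_le_one_right hσ.le (Real.exp_le_one_iff.2 ?_)
        nlinarith [ht.1]
    simpa [MeasureTheory.measureReal_def, hs] using h
  rw [integral_exponentialMeasure hσ, integral_exponentialMeasure hσ, hsplit, add_sub_assoc]
  set I := ∫ t in Set.Ioi 0, ((σ * Real.exp (-σ * t) : ℝ) : ℂ) * H (y - s - t) with hI
  have hIB : ‖I‖ ≤ B := hbd (y - s)
  have h2 : (Real.exp (-σ * s) : ℂ) * I - I = ((Real.exp (-σ * s) - 1 : ℝ) : ℂ) * I := by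
    push_cast; ring
  have h3 : |Real.exp (-σ * s) - 1| ≤ σ * s := by
    have a1 := Real.add_one_le_exp (-σ * s)
    have a2 : Real.exp (-σ * s) ≤ 1 := Real.exp_le_one_iff.2 (by nlinarith)
    rw [abs_of_nonpos (by linarith)]
    linarith
  refine (norm_add_le _ _).trans ?_
  rw [h2, norm_mul, Complex.norm_real, Real.norm_eq_abs]
  have h4 : |Real.exp (-σ * s) - 1| * ‖I‖ ≤ σ * s * B :=
    mul_le_mul h3 hIB (norm_nonneg _) (by positivity)
  linarith

/-- At `1 + σ` the pole contributes exactly `σ · (1/σ) = 1`, and the holomorphic part is bounded on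
`[1, 2]`. -/
lemma exists_abs_tsum_mangoldtWeight_sub_one_le :
    ∃ B : ℝ, 0 ≤ B ∧ ∀ σ : ℝ, 0 < σ → σ ≤ 1 → |∑' n, mangoldtWeight σ n - 1| ≤ B * σ := by
  obtain ⟨A, U, hU, hUre, hA, hLA⟩ := exists_LSeries_vonMangoldt_eq_add
  have hc : ContinuousOn (fun σ : ℝ => A (1 + σ)) (Set.Icc 0 1) :=
    hA.continuousOn.comp (by fun_prop) fun σ hσ => hUre (by simpa using hσ.1)
  obtain ⟨B, hB⟩ := isCompact_Icc.exists_bound_of_continuousOn hc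
  refine ⟨B, (norm_nonneg _).trans (hB 0 (by simp)), fun σ hσ hσ1 => ?_⟩
  have h := (hasSum_mangoldtWeight_mul_exp hσ 0).tsum_eq
  simp only [zero_mul, Complex.ofReal_zero, Complex.exp_zero, mul_one, sub_zero] at h
  rw [hLA _ (by simpa using hσ), add_sub_cancel_left, ← Complex.ofReal_tsum, mul_add,
    mul_one_div_cancel (by exact_mod_cast hσ.ne')] at h
  rw [← Real.norm_eq_abs, ← Complex.norm_real, Complex.ofReal_sub, h, Complex.ofReal_one,
    add_sub_cancel_left, norm_mul, Complex.norm_real, Real.norm_of_nonneg hσ.le, mul_comm]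
  exact mul_le_mul_of_nonneg_right (hB σ ⟨hσ.le, hσ1⟩) hσ.le

/-! ### Construction of the prime weights -/

/-- This makes the proper prime powers negligible once multiplied by `σ`. Modulus one makes the
residue class all of `ℕ`. -/
lemma summable_vonMangoldt_non_primes_div :
    Summable fun n : ℕ => (if n.Prime then 0 else ArithmeticFunction.vonMangoldt n) / (n : ℝ) := by
  refine (ArithmeticFunction.vonMangoldt.summable_residueClass_non_primes_div
    (0 : ZMod 1)).congr fun n => ?_
  have : (n : ZMod 1) = 0 := Subsingleton.elim _ _
  simp [ArithmeticFunction.vonMangoldt.residueClass, Set.indicator, this]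

lemma mangoldtWeight_le_div {σ : ℝ} (hσ : 0 ≤ σ) (n : ℕ) :
    mangoldtWeight σ n ≤ σ * (ArithmeticFunction.vonMangoldt n / n) := by
  rcases eq_or_ne n 0 with rfl | hn
  · simp [mangoldtWeight]
  have hn' : (1 : ℝ) ≤ n := by exact_mod_cast Nat.one_le_iff_ne_zero.2 hn
  have h : (n : ℝ) ^ (-(1 + σ)) ≤ (n : ℝ)⁻¹ := by
    rw [← Real.rpow_neg_one]
    exact Real.rpow_le_rpow_of_exponent_le hn' (by linarith)
  rw [mangoldtWeight, mul_assoc, div_eq_mul_inv]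
  exact mul_le_mul_of_nonneg_left
    (mul_le_mul_of_nonneg_left h ArithmeticFunction.vonMangoldt_nonneg) hσ

/-- With `u = σ log p` this is `u * e^{-u}`, whose peak `1/e` does not shrink with `σ`. A single `σ`
is therefore useless for Turán–Kubilius, and several scales must be averaged. -/
lemma mul_mangoldtWeight_prime {p : ℕ} (hp : p.Prime) (σ : ℝ) :
    p * mangoldtWeight σ p = (σ * Real.log p) * Real.exp (-(σ * Real.log p)) := by
  have hp0 : (0 : ℝ) < p := by exact_mod_cast hp.pos
  rw [mangoldtWeight, ArithmeticFunction.vonMangoldt_apply_prime hp, neg_add, Real.rpow_add hp0,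
    Real.rpow_neg_one, Real.rpow_def_of_pos hp0]
  field_simp

/-- From `e^{u/2} ≥ 1 + u/2` follows `u * e^{-u} ≤ 2(e^{-u/2} - e^{-u})`, which telescopes under
halving. For `x ≥ 0` the bound is at most 2 for every `J`. -/
lemma sum_mul_exp_neg_div_two_pow_le (x : ℝ) (J : ℕ) :
    ∑ j ∈ Finset.range J, (x / 2 ^ j) * Real.exp (-(x / 2 ^ j))
      ≤ 2 * (Real.exp (-(x / 2 ^ J)) - Real.exp (-x)) := by
  have h : ∀ j : ℕ, (x / 2 ^ j) * Real.exp (-(x / 2 ^ j))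
      ≤ 2 * Real.exp (-(x / 2 ^ (j + 1))) - 2 * Real.exp (-(x / 2 ^ j)) := by
    intro j
    set u := x / 2 ^ j with hu
    have hu2 : x / 2 ^ (j + 1) = u / 2 := by rw [hu, pow_succ, div_div]
    have h1 : Real.exp (-(u / 2)) = Real.exp (-u) * Real.exp (u / 2) := by
      rw [← Real.exp_add]; congr 1; ring
    rw [hu2, h1]
    nlinarith [Real.exp_pos (-u), Real.add_one_le_exp (u / 2)]
  refine (Finset.sum_le_sum fun j _ => h j).trans (le_of_eq ?_)
  rw [Finset.sum_range_sub fun j => 2 * Real.exp (-(x / 2 ^ j))]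
  simp only [pow_zero, div_one]
  ring

lemma norm_tsum_sub_sum_le {v : ℕ → ℝ} (hv : ∀ n, 0 ≤ v n) (hs : Summable v) {h : ℕ → ℂ} {H : ℝ}
    (hH : ∀ n, ‖h n‖ ≤ H) (P : Finset ℕ) :
    ‖∑' n, (v n : ℂ) * h n - ∑ n ∈ P, (v n : ℂ) * h n‖ ≤ H * (∑' n, v n - ∑ n ∈ P, v n) := by
  have hb : ∀ n, ‖(v n : ℂ) * h n‖ ≤ H * v n := by
    intro n
    rw [norm_mul, Complex.norm_real, Real.norm_of_nonneg (hv n), mul_comm]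
    exact mul_le_mul_of_nonneg_right (hH n) (hv n)
  have hs' : Summable fun n => (v n : ℂ) * h n := (hs.mul_left H).of_norm_bounded hb
  rw [← hs'.sum_add_tsum_compl (s := P), ← hs.sum_add_tsum_compl (s := P), add_sub_cancel_left,
    add_sub_cancel_left]
  exact tsum_of_norm_bounded ((hs.subtype _).hasSum.mul_left H) fun n => hb n

/-- Finitely supported weights on primes, negligible at each prime in the Turán–Kubilius sense,
against which smoothed bounded functions have almost translation invariant averages. -/
lemma exists_weights {ψ : ℝ → ℂ} (hψ : ContDiff ℝ 2 ψ)
    (hψs : HasCompactSupport ψ) (hk : MeasureTheory.Integrable (𝓕 ψ)) (hkc : Measurable (𝓕 ψ))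
    {ε : ℝ} (hε : ε ≠ 0) {δ : ℝ} (hδ : 0 < δ) {S : ℝ} (hS : 0 ≤ S) :
    ∃ (P : Finset ℕ) (w : ℕ → ℝ), (∀ p ∈ P, p.Prime) ∧ (∀ p, 0 ≤ w p) ∧
      (∀ p ∈ P, p * w p ≤ δ) ∧ 1 / 2 ≤ ∑ p ∈ P, w p ∧ ∑ p ∈ P, w p ≤ 2 ∧
      ∀ G : ℝ → ℂ, Measurable G → (∀ y, ‖G y‖ ≤ 1) → ∀ y s : ℝ, 0 ≤ s → s ≤ S →
        ‖∑ p ∈ P, (w p : ℂ) * (smoothing (𝓕 ψ) ε G (y - Real.log p)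
          - smoothing (𝓕 ψ) ε G (y - s - Real.log p))‖ ≤ δ := by
  obtain ⟨C, hC, hCM⟩ := exists_norm_tsum_sub_integral_le hψ hψs hk hkc hε
  obtain ⟨B, hB, hBM⟩ := exists_abs_tsum_mangoldtWeight_sub_one_le
  set C0 := ∫ u, ‖𝓕 ψ u‖ with hC0
  have hC0nn : 0 ≤ C0 := MeasureTheory.integral_nonneg fun _ => norm_nonneg _
  set Q := ∑' n : ℕ, (if n.Prime then 0 else ArithmeticFunction.vonMangoldt n) / (n : ℝ) with hQ
  have hQnn : 0 ≤ Q := tsum_nonneg fun n => by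
    have := ArithmeticFunction.vonMangoldt_nonneg (n := n)
    split_ifs <;> positivity
  -- Averaging `J` dyadic scales gives `p * w p ≤ 2 / J`.
  obtain ⟨J, hJ⟩ := exists_nat_gt (2 / δ)
  have hJ0 : (0 : ℝ) < J := (by positivity : (0 : ℝ) < 2 / δ).trans hJ
  -- Restriction to finitely many primes will lose mass at most `2 * δ₁`: this keeps the total above
  -- `1/2` and costs at most `4 * C0 * δ₁ ≤ δ / 2` in the final average.
  set δ₁ := min (1 / 8) (δ / (8 * (C0 + 1))) with hδ₁
  have hδ₁pos : 0 < δ₁ := by positivity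
  -- One term per demand on `σ₀`: total mass near 1, prime powers below `δ₁`, and translation error
  -- below `δ / 2` (two comparisons with the exponential law and one shift of it).
  set E := (B + Q / δ₁ + (2 * C + 2 * C0 * S) / δ) with hE
  have hEnn : 0 ≤ E := by positivity
  set σ₀ := 1 / (8 * (E + 1)) with hσ₀
  have hσ₀pos : 0 < σ₀ := by positivity
  have hσ₀E : σ₀ * E ≤ 1 / 8 := by
    rw [hσ₀, div_mul_eq_mul_div, div_le_div_iff₀ (by positivity) (by norm_num)]
    linarith
  have hσ₀1 : σ₀ ≤ 1 := by
    rw [hσ₀, div_le_one (by positivity)]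
    linarith
  have hp1 : 0 ≤ Q / δ₁ := by positivity
  have hp2 : 0 ≤ (2 * C + 2 * C0 * S) / δ := by positivity
  have hσB : B * σ₀ ≤ 1 / 8 := by nlinarith
  have hσQ : σ₀ * Q ≤ δ₁ := by
    have h1 : σ₀ * (Q / δ₁) ≤ 1 := by nlinarith
    rw [← mul_div_assoc, div_le_one hδ₁pos] at h1
    exact h1
  have hσC : (2 * C + 2 * C0 * S) * σ₀ ≤ δ / 2 := by
    have h1 : σ₀ * ((2 * C + 2 * C0 * S) / δ) ≤ 1 / 2 := by nlinarith
    rw [← mul_div_assoc, div_le_iff₀ hδ] at h1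
    linarith
  set σ : ℕ → ℝ := fun j => σ₀ / 2 ^ j with hσ
  have hσpos : ∀ j, 0 < σ j := fun j => by positivity
  have hσle : ∀ j, σ j ≤ σ₀ := fun j => div_le_self hσ₀pos.le (one_le_pow₀ (by norm_num))
  set v : ℕ → ℝ := fun n => (J : ℝ)⁻¹ * ∑ j ∈ Finset.range J, mangoldtWeight (σ j) n with hv
  have hvnn : ∀ n, 0 ≤ v n := fun n => mul_nonneg (by positivity)
    (Finset.sum_nonneg fun j _ => mangoldtWeight_nonneg (hσpos j).le n)
  have havg : ∀ c : ℝ, (J : ℝ)⁻¹ * ∑ j ∈ Finset.range J, c = c := fun c => by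
    simp only [Finset.sum_const, Finset.card_range, nsmul_eq_mul]
    field_simp
  have hvsum : HasSum v ((J : ℝ)⁻¹ * ∑ j ∈ Finset.range J, ∑' n, mangoldtWeight (σ j) n) :=
    (hasSum_sum fun j _ => (summable_mangoldtWeight (hσpos j)).hasSum).mul_left _
  have hVj : ∀ j, |∑' n, mangoldtWeight (σ j) n - 1| ≤ 1 / 8 := fun j =>
    (hBM (σ j) (hσpos j) ((hσle j).trans hσ₀1)).trans
      ((mul_le_mul_of_nonneg_left (hσle j) hB).trans hσB)
  have hVlow : 7 / 8 ≤ ∑' n, v n := by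
    rw [hvsum.tsum_eq, ← havg (7 / 8)]
    gcongr with j
    linarith [(abs_le.1 (hVj j)).1]
  have hVup : ∑' n, v n ≤ 9 / 8 := by
    rw [hvsum.tsum_eq, ← havg (9 / 8)]
    gcongr with j
    linarith [(abs_le.1 (hVj j)).2]
  have hule : ∀ n : ℕ, (if n.Prime then 0 else v n)
      ≤ σ₀ * ((if n.Prime then 0 else ArithmeticFunction.vonMangoldt n) / (n : ℝ)) := by
    intro n
    have hΛ : 0 ≤ ArithmeticFunction.vonMangoldt n / (n : ℝ) :=
      div_nonneg ArithmeticFunction.vonMangoldt_nonneg (Nat.cast_nonneg n)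
    split_ifs with hn
    · simp
    · refine le_trans ?_ (havg _).le
      exact mul_le_mul_of_nonneg_left (Finset.sum_le_sum fun j _ =>
        (mangoldtWeight_le_div (hσpos j).le n).trans
          (mul_le_mul_of_nonneg_right (hσle j) hΛ)) (by positivity)
  have hunn : ∀ n : ℕ, 0 ≤ (if n.Prime then 0 else v n) := fun n => by
    split_ifs
    exacts [le_rfl, hvnn n]
  have husum : Summable fun n : ℕ => if n.Prime then 0 else v n :=
    Summable.of_nonneg_of_le hunn hule (summable_vonMangoldt_non_primes_div.mul_left σ₀)
  have hU : ∑' n : ℕ, (if n.Prime then 0 else v n) ≤ δ₁ := by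
    refine (husum.tsum_le_tsum hule (summable_vonMangoldt_non_primes_div.mul_left σ₀)).trans ?_
    rw [tsum_mul_left]
    exact hσQ
  have htend := (hvsum.summable.hasSum.sub husum.hasSum).tendsto_sum_nat
  -- The primes below `T` carry all but `δ₁` of the mass on primes.
  obtain ⟨T, hT⟩ := (htend.eventually (lt_mem_nhds (sub_lt_self _ hδ₁pos))).exists
  set P := (Finset.range T).filter Nat.Prime with hP
  have hPsum : ∑ n ∈ Finset.range T, (v n - if n.Prime then 0 else v n) = ∑ p ∈ P, v p := by
    rw [hP, Finset.sum_filter]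
    exact Finset.sum_congr rfl fun n _ => by split_ifs <;> simp
  rw [hPsum] at hT
  have hrest : ∑' n, v n - ∑ p ∈ P, v p ≤ 2 * δ₁ := by linarith
  have hδ₁8 : δ₁ ≤ 1 / 8 := min_le_left _ _
  have hδ₁C : δ₁ * (8 * (C0 + 1)) ≤ δ := (le_div_iff₀ (by positivity)).1 (min_le_right _ _)
  refine ⟨P, v, fun p hp => (Finset.mem_filter.1 hp).2, hvnn, ?_, by linarith, ?_, ?_⟩
  · intro p hp
    have hpp := (Finset.mem_filter.1 hp).2
    have h1 : p * v p = (J : ℝ)⁻¹ * ∑ j ∈ Finset.range J,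
        ((σ₀ * Real.log p) / 2 ^ j) * Real.exp (-((σ₀ * Real.log p) / 2 ^ j)) := by
      rw [hv, mul_left_comm, Finset.mul_sum]
      congr 1
      refine Finset.sum_congr rfl fun j _ => ?_
      rw [mul_mangoldtWeight_prime hpp, hσ, div_mul_eq_mul_div]
    have hx : 0 ≤ σ₀ * Real.log p := mul_nonneg hσ₀pos.le (Real.log_natCast_nonneg p)
    have h2 := sum_mul_exp_neg_div_two_pow_le (σ₀ * Real.log p) J
    have h3 : Real.exp (-((σ₀ * Real.log p) / 2 ^ J)) ≤ 1 :=
      Real.exp_le_one_iff.2 (neg_nonpos.2 (by positivity))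
    have h4 := Real.exp_pos (-(σ₀ * Real.log p))
    rw [h1]
    calc _ ≤ (J : ℝ)⁻¹ * 2 := by gcongr; linarith
      _ ≤ δ := by
        rw [inv_mul_le_iff₀ hJ0]
        exact ((div_lt_iff₀ hδ).1 hJ).le
  · linarith [hvsum.summable.sum_le_tsum P fun n _ => hvnn n]
  intro G hG hG1 y s hs hsS
  set H := smoothing (𝓕 ψ) ε G with hH
  have hHC : ∀ y, ‖H y‖ ≤ C0 := norm_smoothing_le hk hG1 ε
  have hHm : Measurable H := measurable_smoothing hkc hG ε
  set D : ℕ → ℂ := fun n => H (y - Real.log n) - H (y - s - Real.log n) with hD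
  have hDC : ∀ n, ‖D n‖ ≤ 2 * C0 := fun n =>
    (norm_sub_le _ _).trans (by linarith [hHC (y - Real.log n), hHC (y - s - Real.log n)])
  have hsumH : ∀ (j : ℕ) (h : ℕ → ℂ) (M : ℝ), (∀ n, ‖h n‖ ≤ M) →
      Summable fun n => (mangoldtWeight (σ j) n : ℂ) * h n := by
    intro j h M hM
    refine ((summable_mangoldtWeight (hσpos j)).mul_right M).of_norm_bounded fun n => ?_
    rw [norm_mul, Complex.norm_real, Real.norm_of_nonneg (mangoldtWeight_nonneg (hσpos j).le n)]
    exact mul_le_mul_of_nonneg_left (hM n) (mangoldtWeight_nonneg (hσpos j).le n)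
  have hj : ∀ j, ‖∑' n, (mangoldtWeight (σ j) n : ℂ) * D n‖ ≤ δ / 2 := by
    intro j
    have a1 := hCM (σ j) (hσpos j) ((hσle j).trans hσ₀1) G hG hG1 y
    have a2 := hCM (σ j) (hσpos j) ((hσle j).trans hσ₀1) G hG hG1 (y - s)
    have a3 := norm_integral_exponentialMeasure_sub_le (hσpos j) hHm hHC hs y
    have a4 : ∑' n, (mangoldtWeight (σ j) n : ℂ) * D n
        = ∑' n : ℕ, (mangoldtWeight (σ j) n : ℂ) * H (y - Real.log n)
          - ∑' n : ℕ, (mangoldtWeight (σ j) n : ℂ) * H (y - s - Real.log n) := by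
      rw [← (hsumH j _ C0 fun n => hHC _).tsum_sub (hsumH j _ C0 fun n => hHC _)]
      simp_rw [hD, mul_sub]
    set X₁ := ∑' n : ℕ, (mangoldtWeight (σ j) n : ℂ) * H (y - Real.log n)
    set X₂ := ∑' n : ℕ, (mangoldtWeight (σ j) n : ℂ) * H (y - s - Real.log n)
    set I₁ := ∫ t, H (y - t) ∂(exponentialMeasure (σ j))
    set I₂ := ∫ t, H (y - s - t) ∂(exponentialMeasure (σ j))
    have a5 : X₁ - X₂ = (X₁ - I₁) + (I₁ - I₂) - (X₂ - I₂) := by ring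
    rw [a4, a5]
    refine (norm_sub_le _ _).trans ((add_le_add (norm_add_le _ _) le_rfl).trans ?_)
    have a6 : 2 * C0 * s ≤ 2 * C0 * S := by gcongr
    have a7 : (2 * C + 2 * C0 * s) * σ j ≤ (2 * C + 2 * C0 * S) * σ₀ :=
      mul_le_mul (by linarith) (hσle j) (hσpos j).le (by positivity)
    linarith
  have hmain : ‖∑' n, (v n : ℂ) * D n‖ ≤ δ / 2 := by
    have b1 : ∑' n, (v n : ℂ) * D n
        = ((J : ℝ)⁻¹ : ℂ) * ∑ j ∈ Finset.range J, ∑' n, (mangoldtWeight (σ j) n : ℂ) * D n := by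
      rw [← (Summable.tsum_finsetSum fun j _ => hsumH j D _ hDC), ← tsum_mul_left]
      refine tsum_congr fun n => ?_
      rw [hv, ← Finset.sum_mul]
      push_cast
      ring
    rw [b1, norm_mul, ← havg (δ / 2)]
    have b2 : ‖((J : ℝ)⁻¹ : ℂ)‖ = (J : ℝ)⁻¹ := by simp
    rw [b2]
    gcongr
    exact norm_sum_le_of_le _ fun j _ => hj j
  have htail := norm_tsum_sub_sum_le hvnn hvsum.summable hDC P
  have hfin : ‖∑ p ∈ P, (v p : ℂ) * D p‖ ≤ δ / 2 + 2 * C0 * (2 * δ₁) := by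
    have c1 : ∑ p ∈ P, (v p : ℂ) * D p
        = ∑' n, (v n : ℂ) * D n - (∑' n, (v n : ℂ) * D n - ∑ p ∈ P, (v p : ℂ) * D p) := by ring
    rw [c1]
    refine (norm_sub_le _ _).trans (add_le_add hmain (htail.trans ?_))
    gcongr
  refine hfin.trans ?_
  nlinarith

/-! ### Slow variation and shift invariance of the means of `Ω` -/

/-- For a smooth bump `ψ`, Fourier inversion at 0 gives `∫ 𝓕 ψ = ψ 0 = 1`, and `𝓕 ψ` is Schwartz.
Compact support of `ψ` confines the use of `ζ` to a bounded vertical segment. -/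
lemma exists_fourier_kernel :
    ∃ ψ : ℝ → ℂ, ContDiff ℝ 2 ψ ∧ HasCompactSupport ψ ∧ MeasureTheory.Integrable (𝓕 ψ) ∧
      Measurable (𝓕 ψ) ∧ MeasureTheory.Integrable (fun u => |u| * ‖𝓕 ψ u‖) ∧
      ∫ u, 𝓕 ψ u = 1 := by
  let g : ContDiffBump (0 : ℝ) := default
  let ψ : ℝ → ℂ := fun x => (g x : ℂ)
  have hψ : ContDiff ℝ (⊤ : ℕ∞) ψ := Complex.ofRealCLM.contDiff.comp g.contDiff
  have hψs : HasCompactSupport ψ := g.hasCompactSupport.comp_left Complex.ofReal_zero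
  let Ψ : SchwartzMap ℝ ℂ := hψs.toSchwartzMap hψ
  let Θ : SchwartzMap ℝ ℂ := 𝓕 Ψ
  have hcoe : (Θ : ℝ → ℂ) = 𝓕 ψ := SchwartzMap.fourier_coe Ψ
  have hI : MeasureTheory.Integrable (𝓕 ψ) := hcoe ▸ Θ.integrable
  have hψi : MeasureTheory.Integrable ψ := hψ.continuous.integrable_of_hasCompactSupport hψs
  refine ⟨ψ, by exact_mod_cast contDiff_infty.1 hψ 2, hψs, hI, ?_, ?_, ?_⟩
  · rw [← hcoe]
    exact Θ.continuous.measurable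
  · simpa [hcoe] using Θ.integrable_pow_mul MeasureTheory.volume 1
  · have h1 := congrFun (hψ.continuous.fourierInv_fourier_eq hψi hI) 0
    rw [Real.fourierInv_eq'] at h1
    have h2 : ψ 0 = 1 := by
      show ((g 0 : ℝ) : ℂ) = 1
      rw [g.one_of_mem_closedBall (by simpa using g.rIn_pos.le)]
      simp
    rw [h2] at h1
    simpa using h1

/-- The mean value of `f (Ω n)` over `1 ≤ n ≤ exp y`. -/
noncomputable def omegaMean (f : ℕ → ℂ) (y : ℝ) : ℂ :=
  logMean (fun n => f (ArithmeticFunction.cardFactors n)) y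

/-- Complete additivity: every prime shifts `Ω` by the same amount, so the averaged function does
not depend on `p`. -/
lemma logMean_cardFactors_prime_mul (f : ℕ → ℂ) {p : ℕ} (hp : p.Prime) (y : ℝ) :
    logMean (fun m => f (ArithmeticFunction.cardFactors (p * m))) y
      = omegaMean (fun k => f (k + 1)) y := by
  rw [omegaMean, logMean, logMean]
  congr 1
  refine Finset.sum_congr rfl fun m hm => ?_
  have hm0 : m ≠ 0 := (Nat.pos_of_ne_zero (by have := (Finset.mem_Icc.1 hm).1; omega)).ne'
  rw [ArithmeticFunction.cardFactors_mul hp.ne_zero hm0,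
    ArithmeticFunction.cardFactors_apply_prime hp, add_comm]

lemma norm_mul_omegaMean_sub_sum_le {P : Finset ℕ} (hP : ∀ p ∈ P, p.Prime) {w : ℕ → ℝ}
    (hw : ∀ p, 0 ≤ w p) {η : ℝ} (hη : ∀ p ∈ P, p * w p ≤ η) (hη0 : 0 ≤ η)
    (hW : ∑ p ∈ P, w p ≤ 2) {f : ℕ → ℂ} (hf : ∀ n, ‖f n‖ ≤ 1) {r y : ℝ} (hr : 0 ≤ r)
    (hr1 : 2 * η + 4 * (∑ p ∈ P, p * w p) * Real.exp (-y) ≤ r ^ 2) :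
    ‖((∑ p ∈ P, w p : ℝ) : ℂ) * omegaMean f y
        - ∑ p ∈ P, (w p : ℂ) * omegaMean (fun k => f (k + 1)) (y - Real.log p)‖ ≤ r := by
  have h := norm_mul_logMean_sub_sum_sq_le hP (fun p _ => hw p) hη
    (b := fun n => f (ArithmeticFunction.cardFactors n)) (fun n => hf _) y
  have hsum : ∑ p ∈ P, (w p : ℂ) *
        logMean (fun m => f (ArithmeticFunction.cardFactors (p * m))) (y - Real.log p)
      = ∑ p ∈ P, (w p : ℂ) * omegaMean (fun k => f (k + 1)) (y - Real.log p) :=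
    Finset.sum_congr rfl fun p hp => by rw [logMean_cardFactors_prime_mul f (hP p hp)]
  rw [hsum] at h
  refine le_of_sq_le_sq (h.trans (le_trans ?_ hr1)) hr
  have h1 : 0 ≤ ∑ p ∈ P, p * w p := Finset.sum_nonneg fun p _ => mul_nonneg (by positivity) (hw p)
  have h2 : η * ∑ p ∈ P, w p ≤ η * 2 := mul_le_mul_of_nonneg_left hW hη0
  have h3 : (∑ p ∈ P, w p) * ((∑ p ∈ P, p * w p) * Real.exp (-y))
      ≤ 2 * ((∑ p ∈ P, p * w p) * Real.exp (-y)) :=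
    mul_le_mul_of_nonneg_right hW (mul_nonneg h1 (Real.exp_pos _).le)
  linarith

lemma exists_forall_exp_neg_le {κ : ℝ} (hκ : 0 < κ) : ∃ Y : ℝ, ∀ y, Y ≤ y → Real.exp (-y) ≤ κ :=
  ⟨-Real.log κ, fun y hy => by
    rw [← Real.le_log_iff_exp_le hκ]
    linarith⟩

/-- Mean values of bounded functions of `Ω` vary slowly under dilation. -/
lemma exists_norm_omegaMean_sub_shift_le {δ : ℝ} (hδ : 0 < δ) {S : ℝ} (hS : 0 ≤ S) :
    ∃ Y : ℝ, ∀ y, Y ≤ y → ∀ s, 0 ≤ s → s ≤ S → ∀ f : ℕ → ℂ, (∀ n, ‖f n‖ ≤ 1) →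
      ‖omegaMean f y - omegaMean f (y - s)‖ ≤ δ := by
  obtain ⟨ψ, hψ, hψs, hk, hkc, hk', hk1⟩ := exists_fourier_kernel
  set C0 := ∫ u, ‖𝓕 ψ u‖ with hC0
  set C1 := ∫ u, |u| * ‖𝓕 ψ u‖ with hC1
  have hC0nn : 0 ≤ C0 := MeasureTheory.integral_nonneg fun _ => norm_nonneg _
  have hC1nn : 0 ≤ C1 := MeasureTheory.integral_nonneg fun _ => by positivity
  -- Smoothing at scale `ε` costs `2 * ε * C1` per unit of weight, and the total weight is at most
  -- 2.
  set ε := δ / (64 * (C1 + 1)) with hε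
  have hεpos : 0 < ε := by positivity
  have hεC : 4 * ε * C1 ≤ δ / 16 := by
    have : ε * (64 * (C1 + 1)) = δ := div_mul_cancel₀ _ (by positivity)
    nlinarith
  set r := δ / 16 with hr
  have hrpos : 0 < r := by positivity
  set δ' := min (r ^ 2 / 4) (δ / 16) with hδ'
  have hδ'pos : 0 < δ' := by positivity
  obtain ⟨P, w, hP, hw, hη, hW1, hW2, hmain⟩ := exists_weights hψ hψs hk hkc hεpos.ne' hδ'pos hS
  set W := ∑ p ∈ P, w p with hWdef
  set Sp := ∑ p ∈ P, p * w p with hSp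
  have hSpnn : 0 ≤ Sp := Finset.sum_nonneg fun p _ => mul_nonneg (by positivity) (hw p)
  -- `exp (-x) * K ≤ 1` controls both rounding errors, from Turán–Kubilius and from smoothing.
  set K := 8 * Sp / r ^ 2 + 16 * C0 * Sp / δ with hK
  have hKnn : 0 ≤ K := by positivity
  obtain ⟨Y, hY⟩ := exists_forall_exp_neg_le (κ := 1 / (K + 1)) (by positivity)
  -- `P` and `w` are fixed before `f`, whence uniformity; the extra `S` keeps `y - s` beyond `Y`.
  refine ⟨Y + S, fun y hy s hs hsS f hf => ?_⟩
  have hexp : ∀ x, y - S ≤ x → 2 * δ' + 4 * Sp * Real.exp (-x) ≤ r ^ 2 ∧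
      C0 * Sp * Real.exp (-x) ≤ δ / 16 := by
    intro x hx
    have h1 := hY x (by linarith)
    have he := Real.exp_pos (-x)
    have h2 : Real.exp (-x) * K ≤ 1 := by
      rw [le_div_iff₀ (by positivity)] at h1
      linarith
    have p1 : 0 ≤ 8 * Sp / r ^ 2 := by positivity
    have p2 : 0 ≤ 16 * C0 * Sp / δ := by positivity
    constructor
    · have h3 : Real.exp (-x) * (8 * Sp / r ^ 2) ≤ 1 := by nlinarith
      rw [← mul_div_assoc, div_le_one (by positivity)] at h3
      have h4 : δ' ≤ r ^ 2 / 4 := min_le_left _ _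
      linarith
    · have h3 : Real.exp (-x) * (16 * C0 * Sp / δ) ≤ 1 := by nlinarith
      rw [← mul_div_assoc, div_le_one (by positivity)] at h3
      linarith
  set f' : ℕ → ℂ := fun k => f (k + 1) with hf'
  have hf'1 : ∀ n, ‖f' n‖ ≤ 1 := fun n => hf _
  have hTK : ∀ x, y - S ≤ x → ‖(W : ℂ) * omegaMean f x
      - ∑ p ∈ P, (w p : ℂ) * omegaMean f' (x - Real.log p)‖ ≤ r := fun x hx =>
    norm_mul_omegaMean_sub_sum_le hP hw hη hδ'pos.le hW2 hf hrpos.le (hexp x hx).1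
  have hsm : ∀ x, y - S ≤ x → ‖∑ p ∈ P, (w p : ℂ) * omegaMean f' (x - Real.log p)
      - ∑ p ∈ P, (w p : ℂ) * smoothing (𝓕 ψ) ε (omegaMean f') (x - Real.log p)‖ ≤ δ / 8 := by
    intro x hx
    rw [← Finset.sum_sub_distrib]
    have hterm : ∀ p ∈ P, ‖(w p : ℂ) * omegaMean f' (x - Real.log p)
        - (w p : ℂ) * smoothing (𝓕 ψ) ε (omegaMean f') (x - Real.log p)‖
        ≤ w p * (2 * ε * C1) + C0 * Real.exp (-x) * (p * w p) := by
      intro p hp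
      have hp0 : (0 : ℝ) < p := by exact_mod_cast (hP p hp).pos
      have h := norm_smoothing_logMean_sub_le hk hk' hk1 hεpos.le
        (b := fun n => f' (ArithmeticFunction.cardFactors n)) (fun n => hf'1 _) (x - Real.log p)
      rw [neg_sub, sub_eq_add_neg (Real.log p), Real.exp_add, Real.exp_log hp0, norm_sub_rev] at h
      rw [← mul_sub, norm_mul, Complex.norm_real, Real.norm_of_nonneg (hw p)]
      refine (mul_le_mul_of_nonneg_left h (hw p)).trans (le_of_eq ?_)
      ring
    refine (norm_sum_le_of_le _ hterm).trans ?_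
    rw [Finset.sum_add_distrib, ← Finset.sum_mul, ← Finset.mul_sum, ← hWdef, ← hSp]
    have h1 := (hexp x hx).2
    have h2 : W * (2 * ε * C1) ≤ 2 * (2 * ε * C1) :=
      mul_le_mul_of_nonneg_right hW2 (by positivity)
    linarith
  have hG := hmain (omegaMean f') (measurable_logMean _)
    (fun y => norm_logMean_le_one (fun n => hf'1 _) y) y s hs hsS
  simp_rw [mul_sub, Finset.sum_sub_distrib] at hG
  have t1 := hTK y (by linarith)
  have t2 := hTK (y - s) (by linarith)
  have s1 := hsm y (by linarith)
  have s2 := hsm (y - s) (by linarith)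
  have hδ'2 : δ' ≤ δ / 16 := min_le_right _ _
  set a₁ := ∑ p ∈ P, (w p : ℂ) * omegaMean f' (y - Real.log p)
  set a₂ := ∑ p ∈ P, (w p : ℂ) * omegaMean f' (y - s - Real.log p)
  set b₁ := ∑ p ∈ P, (w p : ℂ) * smoothing (𝓕 ψ) ε (omegaMean f') (y - Real.log p)
  set b₂ := ∑ p ∈ P, (w p : ℂ) * smoothing (𝓕 ψ) ε (omegaMean f') (y - s - Real.log p)
  have hWnorm : W * ‖omegaMean f y - omegaMean f (y - s)‖
      = ‖((W * omegaMean f y - a₁) - (W * omegaMean f (y - s) - a₂))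
        + ((a₁ - b₁) - (a₂ - b₂)) + (b₁ - b₂)‖ := by
    have hWn : ‖(W : ℂ)‖ = W := by
      rw [Complex.norm_real, Real.norm_of_nonneg (by linarith)]
    rw [← hWn, ← norm_mul, hWn]
    congr 1
    ring
  -- The total is `7δ/16`, below `W * δ` since `W ≥ 1/2`.
  have hle : W * ‖omegaMean f y - omegaMean f (y - s)‖ ≤ (r + r) + (δ / 8 + δ / 8) + δ' := by
    rw [hWnorm]
    refine (norm_add_le _ _).trans (add_le_add ((norm_add_le _ _).trans (add_le_add ?_ ?_)) hG)
    · exact (norm_sub_le _ _).trans (add_le_add t1 t2)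
    · exact (norm_sub_le _ _).trans (add_le_add s1 s2)
  have hnn := norm_nonneg (omegaMean f y - omegaMean f (y - s))
  nlinarith

/-- The distribution of `Ω` is asymptotically invariant under translation by one, in total
variation. -/
lemma exists_norm_omegaMean_sub_succ_le {δ : ℝ} (hδ : 0 < δ) :
    ∃ Y : ℝ, ∀ y, Y ≤ y → ∀ f : ℕ → ℂ, (∀ n, ‖f n‖ ≤ 1) →
      ‖omegaMean f y - omegaMean (fun k => f (k + 1)) y‖ ≤ δ := by
  obtain ⟨ψ, hψ, hψs, hk, hkc, -, -⟩ := exists_fourier_kernel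
  set r := δ / 8 with hr
  have hrpos : 0 < r := by positivity
  have hη0 : 0 < r ^ 2 / 4 := by positivity
  -- Only smallness of `p * w p` matters here, so scale 1 and shift range 0 are placeholders.
  obtain ⟨P, w, hP, hw, hη, hW1, hW2, -⟩ :=
    exists_weights hψ hψs hk hkc one_ne_zero hη0 le_rfl
  set W := ∑ p ∈ P, w p with hWdef
  set Sp := ∑ p ∈ P, p * w p with hSp
  have hSpnn : 0 ≤ Sp := Finset.sum_nonneg fun p _ => mul_nonneg (by positivity) (hw p)
  have hlog : ∀ p ∈ P, 0 ≤ Real.log (p : ℝ) := fun p _ => Real.log_natCast_nonneg p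
  -- The sum of all `log p` serves as a common bound for each shift `log p`.
  obtain ⟨Y₁, hY₁⟩ := exists_norm_omegaMean_sub_shift_le hrpos (Finset.sum_nonneg hlog)
  obtain ⟨Y₂, hY₂⟩ := exists_forall_exp_neg_le (κ := r ^ 2 / (8 * (Sp + 1))) (by positivity)
  refine ⟨max Y₁ Y₂, fun y hy f hf => ?_⟩
  set f' : ℕ → ℂ := fun k => f (k + 1) with hf'
  have he := hY₂ y ((le_max_right _ _).trans hy)
  rw [le_div_iff₀ (by positivity)] at he
  have hepos := Real.exp_pos (-y)
  have t1 := norm_mul_omegaMean_sub_sum_le hP hw hη hη0.le hW2 hf (y := y) hrpos.le (by nlinarith)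
  have t2 : ‖∑ p ∈ P, (w p : ℂ) * omegaMean f' (y - Real.log p) - (W : ℂ) * omegaMean f' y‖
      ≤ 2 * r := by
    rw [hWdef, Complex.ofReal_sum, Finset.sum_mul, ← Finset.sum_sub_distrib]
    have hterm : ∀ p ∈ P, ‖(w p : ℂ) * omegaMean f' (y - Real.log p) - (w p : ℂ) * omegaMean f' y‖
        ≤ w p * r := by
      intro p hp
      rw [← mul_sub, norm_mul, Complex.norm_real, Real.norm_of_nonneg (hw p), norm_sub_rev]
      exact mul_le_mul_of_nonneg_left (hY₁ y ((le_max_left _ _).trans hy) _ (hlog p hp)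
        (Finset.single_le_sum hlog hp) f' fun n => hf _) (hw p)
    refine (norm_sum_le_of_le _ hterm).trans ?_
    rw [← Finset.sum_mul]
    exact mul_le_mul_of_nonneg_right hW2 hrpos.le
  have hle : W * ‖omegaMean f y - omegaMean f' y‖ ≤ r + 2 * r := by
    have hWn : ‖(W : ℂ)‖ = W := by
      rw [Complex.norm_real, Real.norm_of_nonneg (by linarith)]
    rw [← hWn, ← norm_mul, mul_sub]
    refine (norm_sub_le_norm_sub_add_norm_sub _ _ _).trans (add_le_add t1 t2)
  have hnn := norm_nonneg (omegaMean f y - omegaMean f' y)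
  nlinarith

/-! ### Deduction of the theorem -/

lemma omegaMean_log_natCast (f : ℕ → ℂ) {N : ℕ} (hN : 0 < N) :
    omegaMean f (Real.log N)
      = (1 / (N : ℂ)) * ∑ n ∈ Finset.Icc 1 N, f (ArithmeticFunction.cardFactors n) := by
  have hN' : (0 : ℝ) < N := by exact_mod_cast hN
  rw [omegaMean, logMean, Real.exp_neg, Real.exp_log hN', Nat.floor_natCast]
  simp

theorem mainTheorem4
    (F : ℝ → ℂ) (hF_cont : Continuous F) (hF_supp : HasCompactSupport F)
    (a : ℕ → ℂ) (ha : ∃ M : ℝ, ∀ k : ℕ, ‖a k‖ ≤ M) :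
    Asymptotics.IsLittleO Filter.atTop
      (fun N : ℕ =>
        (1 / (N : ℂ)) * (∑ n ∈ Finset.Icc 1 N,
            F (normalizedOmega N n) * a (ArithmeticFunction.cardFactors n)) -
          (1 / (N : ℂ)) * (∑ n ∈ Finset.Icc 1 N,
            F (normalizedOmega N n) * a (ArithmeticFunction.cardFactors n + 1)))
      (fun _ : ℕ => (1 : ℝ)) := by
  rw [Asymptotics.isLittleO_one_iff, Metric.tendsto_nhds]
  intro δ hδ
  obtain ⟨M, hM⟩ := ha
  obtain ⟨B, hB⟩ := hF_cont.bounded_above_of_compact_support hF_supp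
  have hM0 : 0 ≤ M := (norm_nonneg _).trans (hM 0)
  have hB0 : 0 ≤ B := (norm_nonneg _).trans (hB 0)
  -- Normalises `F·a` to norm at most 1; the added 1 keeps `c` positive.
  set c := B * M + 1 with hc
  have hcpos : 0 < c := by positivity
  obtain ⟨Y, hY⟩ := exists_norm_omegaMean_sub_succ_le (δ := δ / (4 * c)) (by positivity)
  have hunif : UniformContinuous F := hF_supp.uniformContinuous_of_continuous hF_cont
  obtain ⟨ρ, hρ, hFρ⟩ := Metric.uniformContinuous_iff.1 hunif (δ / (4 * (M + 1))) (by positivity)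
  have hloglog : Filter.Tendsto (fun N : ℕ => Real.sqrt (Real.log (Real.log (N : ℝ))))
      Filter.atTop Filter.atTop :=
    Real.tendsto_sqrt_atTop.comp (Real.tendsto_log_atTop.comp
      (Real.tendsto_log_atTop.comp tendsto_natCast_atTop_atTop))
  have hlogN : Filter.Tendsto (fun N : ℕ => Real.log (N : ℝ)) Filter.atTop Filter.atTop :=
    Real.tendsto_log_atTop.comp tendsto_natCast_atTop_atTop
  filter_upwards [hloglog.eventually_gt_atTop (1 / ρ), hlogN.eventually_ge_atTop Y,
    Filter.eventually_gt_atTop 0] with N hNρ hNY hN0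
  have hN0' : (0 : ℝ) < N := by exact_mod_cast hN0
  set R := Real.sqrt (Real.log (Real.log (N : ℝ))) with hR
  have hRpos : 0 < R := (by positivity : 0 < 1 / ρ).trans hNρ
  set g : ℕ → ℂ := fun k => F (((k : ℝ) - Real.log (Real.log (N : ℝ))) / R) with hg
  set f : ℕ → ℂ := fun k => g k * a k / c with hf
  have hf1 : ∀ k, ‖f k‖ ≤ 1 := by
    intro k
    rw [hf, norm_div, norm_mul, Complex.norm_real, Real.norm_of_nonneg hcpos.le,
      div_le_one hcpos]
    have := mul_le_mul (hB (((k : ℝ) - Real.log (Real.log (N : ℝ))) / R)) (hM k)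
      (norm_nonneg _) hB0
    linarith
  have hmain := hY (Real.log N) hNY f hf1
  -- One more prime factor moves the argument of `F` by `1 / R < ρ`.
  have hosc : ∀ k : ℕ, ‖g (k + 1) - g k‖ ≤ δ / (4 * (M + 1)) := by
    intro k
    rw [← dist_eq_norm]
    refine (hFρ ?_).le
    rw [Real.dist_eq, ← sub_div]
    push_cast
    rw [show (k + 1 - Real.log (Real.log (N : ℝ)) - (k - Real.log (Real.log (N : ℝ)))) = 1 by ring,
      abs_of_pos (by positivity)]
    exact (one_div_lt hρ hRpos).1 hNρ
  have herr : ‖(1 / (N : ℂ)) * ∑ n ∈ Finset.Icc 1 N,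
      (g (ArithmeticFunction.cardFactors n + 1) - g (ArithmeticFunction.cardFactors n))
        * a (ArithmeticFunction.cardFactors n + 1)‖ ≤ δ / 4 := by
    have h1 : ∀ n ∈ Finset.Icc 1 N, ‖(g (ArithmeticFunction.cardFactors n + 1)
        - g (ArithmeticFunction.cardFactors n)) * a (ArithmeticFunction.cardFactors n + 1)‖
        ≤ δ / 4 := by
      intro n _
      rw [norm_mul]
      refine (mul_le_mul (hosc _) (hM _) (norm_nonneg _) (by positivity)).trans ?_
      rw [div_mul_eq_mul_div, div_le_div_iff₀ (by positivity) (by norm_num)]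
      nlinarith
    have h2 := norm_sum_le_of_le _ h1
    rw [Finset.sum_const, Nat.card_Icc, Nat.add_sub_cancel, nsmul_eq_mul] at h2
    rw [norm_mul, norm_div, norm_one, Complex.norm_natCast, one_div_mul_eq_div, div_le_iff₀ hN0']
    linarith
  have hcC : (c : ℂ) ≠ 0 := by exact_mod_cast hcpos.ne'
  have hcf : ∀ k, (c : ℂ) * f k = g k * a k := fun k => mul_div_cancel₀ _ hcC
  -- Only `a` is shifted in the theorem, while the mean-value bound shifts the product `g * a`; the
  -- second term corrects for shifting `g`.
  have hdecomp : (1 / (N : ℂ)) * (∑ n ∈ Finset.Icc 1 N,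
            F (normalizedOmega N n) * a (ArithmeticFunction.cardFactors n)) -
          (1 / (N : ℂ)) * (∑ n ∈ Finset.Icc 1 N,
            F (normalizedOmega N n) * a (ArithmeticFunction.cardFactors n + 1))
      = c * (omegaMean f (Real.log N) - omegaMean (fun k => f (k + 1)) (Real.log N))
        + (1 / (N : ℂ)) * ∑ n ∈ Finset.Icc 1 N,
          (g (ArithmeticFunction.cardFactors n + 1) - g (ArithmeticFunction.cardFactors n))
            * a (ArithmeticFunction.cardFactors n + 1) := by
    rw [omegaMean_log_natCast f hN0, omegaMean_log_natCast _ hN0, ← mul_sub, ← mul_sub,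
      mul_left_comm, ← mul_add, ← Finset.sum_sub_distrib, ← Finset.sum_sub_distrib,
      Finset.mul_sum _ _ (c : ℂ), ← Finset.sum_add_distrib]
    congr 1
    refine Finset.sum_congr rfl fun n _ => ?_
    rw [mul_sub, hcf, hcf, sub_mul]
    have : F (normalizedOmega N n) = g (ArithmeticFunction.cardFactors n) := rfl
    rw [this]
    ring
  rw [dist_zero_right, hdecomp]
  refine (norm_add_le _ _).trans_lt ?_
  rw [norm_mul, Complex.norm_real, Real.norm_of_nonneg hcpos.le]
  have h1 := mul_le_mul_of_nonneg_left hmain hcpos.le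
  have h2 : c * (δ / (4 * c)) = δ / 4 := by field_simp
  linarith
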